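/- Let $\rho>0$, let $M=\mathbb{S}^1\times[-\rho,\rho]$, and let $g_0$ be a smooth (up to the boundary) Riemannian metric on $M$, with no symmetry assumed, whose scalar curvature satisfies $R_{g_0}\ge 0$ on $M$ and whose boundary geodesic curvature (with respect to the outward unit normal, so that convex boundaries have $k\ge 0$) satisfies $k_{g_0}\le 0$ on $\partial M$. Then there is a constant $c>0$ (depending only on $\rho$ and $g_0$, not on time) with the following property. Let $0<\tilde T\le\infty$ and let $\tilde g(\tilde t)$, $\tilde t\in[0,\tilde T)$, be a solution of the unnormalised Ricci flow \[ \frac{\partial\tilde g}{\partial\tilde t}=-\tilde R\,\tilde g\ \text{ in } M\times(0,\tilde T),\qquad k_{\tilde g}=k_{g_0}\ \text{ on } \partial M\times(0,\tilde T),\qquad \tilde g(0)=g_0 , \] where $\tilde R$ is the scalar curvature of $\tilde g$, and where $\tilde g$ is smooth up to the boundary for $\tilde t>0$ and continuous, together with its spatial derivatives of order at most two, on $M\times[0,\tilde T)$. Then \[ \int_M\tilde R\,dA_{\tilde g}\le\frac{c}{\tilde t}\qquad\text{for all }\tilde t\in(0,\tilde T). \] -/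

import Mathlib

open Set
open scoped ContDiff Matrix

noncomputable section

namespace Cylinder

/-- The universal cover `ℝ × [-ρ, ρ]` of the cylinder `S¹ × [-ρ, ρ]`, with coordinates `(θ, s)`.
Tensor fields on the cylinder are those on the strip that are `2π`-periodic in `θ`. -/
def strip (ρ : ℝ) : Set (ℝ × ℝ) := univ ×ˢ Icc (-ρ) ρ

/-- Partial derivatives `∂₀ = ∂/∂θ` and `∂₁ = ∂/∂s` of a function on the strip
(the latter one-sided at the two boundary components `s = ±ρ`). -/
def pd (ρ : ℝ) (i : Fin 2) (f : ℝ × ℝ → ℝ) (p : ℝ × ℝ) : ℝ :=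
  if i = 0 then deriv (fun θ => f (θ, p.2)) p.1
  else derivWithin (fun s => f (p.1, s)) (Icc (-ρ) ρ) p.2

/-- A smooth (up to the boundary) Riemannian metric on the cylinder `S¹ × [-ρ, ρ]`, given by its
matrix in the coordinates `(θ, s)`. -/
structure IsMetric (ρ : ℝ) (g : ℝ × ℝ → Matrix (Fin 2) (Fin 2) ℝ) : Prop where
  smooth : ∀ i j, ContDiffOn ℝ ∞ (fun p => g p i j) (strip ρ)
  periodic : ∀ p ∈ strip ρ, g (p.1 + 2 * Real.pi, p.2) = g p
  posDef : ∀ p ∈ strip ρ, (g p).PosDef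

/-- Christoffel symbols
`Γᵏᵢⱼ = ½ gᵏˡ (∂ᵢ gⱼₗ + ∂ⱼ gᵢₗ - ∂ₗ gᵢⱼ)` of the Levi-Civita connection. -/
def christoffel (ρ : ℝ) (g : ℝ × ℝ → Matrix (Fin 2) (Fin 2) ℝ) (k i j : Fin 2) (p : ℝ × ℝ) : ℝ :=
  (1 / 2) * ∑ l, (g p)⁻¹ k l *
    (pd ρ i (fun q => g q j l) p + pd ρ j (fun q => g q i l) p - pd ρ l (fun q => g q i j) p)

/-- Ricci tensor
`Rᵢⱼ = ∂ₖ Γᵏᵢⱼ - ∂ⱼ Γᵏᵢₖ + Γᵏₖₗ Γˡᵢⱼ - Γᵏⱼₗ Γˡᵢₖ`. -/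
def ricci (ρ : ℝ) (g : ℝ × ℝ → Matrix (Fin 2) (Fin 2) ℝ) (i j : Fin 2) (p : ℝ × ℝ) : ℝ :=
  ∑ k, (pd ρ k (christoffel ρ g k i j) p - pd ρ j (christoffel ρ g k i k) p) +
    ∑ k, ∑ l, (christoffel ρ g k k l p * christoffel ρ g l i j p -
      christoffel ρ g k j l p * christoffel ρ g l i k p)

/-- Scalar curvature `R = gⁱʲ Rᵢⱼ` (twice the Gauss curvature). -/
def scalarCurv (ρ : ℝ) (g : ℝ × ℝ → Matrix (Fin 2) (Fin 2) ℝ) (p : ℝ × ℝ) : ℝ :=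
  ∑ i, ∑ j, (g p)⁻¹ i j * ricci ρ g i j p

/-- The outward unit normal `η = ± grad s / |grad s|` of the boundary component `s = ±ρ`
(for `ρ > 0` and `p.2 = ±ρ`, the sign is that of `p.2`). -/
def outwardNormal (g : ℝ × ℝ → Matrix (Fin 2) (Fin 2) ℝ) (p : ℝ × ℝ) (i : Fin 2) : ℝ :=
  SignType.sign p.2 * (g p)⁻¹ i 1 / √((g p)⁻¹ 1 1)

/-- Geodesic curvature `k_g = -g(∇_τ τ, η)` of the boundary, where `τ = ∂_θ / |∂_θ|` and `η` is the
outward unit normal; the boundary of a convex region has `k_g ≥ 0`.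
(Normalising `∂_θ` only changes `∇_τ τ` by the factor `1 / g(∂_θ, ∂_θ)` and a tangential term.) -/
def geodesicCurv (ρ : ℝ) (g : ℝ × ℝ → Matrix (Fin 2) (Fin 2) ℝ) (p : ℝ × ℝ) : ℝ :=
  -(∑ k, ∑ l, g p k l * christoffel ρ g k 0 0 p * outwardNormal g p l) / g p 0 0

/-- Total scalar curvature `∫_M R dA_g`. -/
def totalScalarCurv (ρ : ℝ) (g : ℝ × ℝ → Matrix (Fin 2) (Fin 2) ℝ) : ℝ :=
  ∫ θ in (0 : ℝ)..(2 * Real.pi), ∫ s in (-ρ)..ρ,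
    scalarCurv ρ g (θ, s) * √((g (θ, s)).det)

/-- `g` is a classical solution, on the time interval `[0, T)` with `T ≤ ∞`, of the (unnormalised)
Ricci flow `∂g/∂t = -R g` on the cylinder, with initial metric `g₀` and with the geodesic curvature
of the boundary kept equal to that of `g₀`. The solution is smooth up to the boundary for positive
times, and its spatial derivatives of order at most two are continuous up to time `0`. (Smoothness
up to time `0` is not asked for: it would impose further compatibility conditions on `g₀`.) -/
structure IsRicciFlow (ρ : ℝ) (T : EReal) (g₀ : ℝ × ℝ → Matrix (Fin 2) (Fin 2) ℝ)
    (g : ℝ → ℝ × ℝ → Matrix (Fin 2) (Fin 2) ℝ) : Prop where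
  metric : ∀ t : ℝ, 0 ≤ t → (t : EReal) < T → IsMetric ρ (g t)
  smooth : ∀ i j, ContDiffOn ℝ ∞ (fun x : ℝ × (ℝ × ℝ) => g x.1 x.2 i j)
    ({t : ℝ | 0 < t ∧ (t : EReal) < T} ×ˢ strip ρ)
  continuousOn_zero : ∀ i j, ContinuousOn (fun x : ℝ × (ℝ × ℝ) => g x.1 x.2 i j)
    ({t : ℝ | 0 ≤ t ∧ (t : EReal) < T} ×ˢ strip ρ)
  continuousOn_one : ∀ i j a, ContinuousOn
    (fun x : ℝ × (ℝ × ℝ) => pd ρ a (fun p => g x.1 p i j) x.2)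
    ({t : ℝ | 0 ≤ t ∧ (t : EReal) < T} ×ˢ strip ρ)
  continuousOn_two : ∀ i j a b, ContinuousOn
    (fun x : ℝ × (ℝ × ℝ) => pd ρ a (pd ρ b (fun p => g x.1 p i j)) x.2)
    ({t : ℝ | 0 ≤ t ∧ (t : EReal) < T} ×ˢ strip ρ)
  evolution : ∀ t : ℝ, 0 < t → (t : EReal) < T → ∀ p ∈ strip ρ, ∀ i j,
    HasDerivAt (fun τ => g τ p i j) (-scalarCurv ρ (g t) p * g t p i j) t
  boundary : ∀ t : ℝ, 0 < t → (t : EReal) < T → ∀ p : ℝ × ℝ, (p.2 = -ρ ∨ p.2 = ρ) →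
    geodesicCurv ρ (g t) p = geodesicCurv ρ g₀ p
  initial : ∀ p ∈ strip ρ, g 0 p = g₀ p

end Cylinder

end

/-! The flow only rescales the metric, so `g t = φ(t) g₀` with `φ > 0` and `φ(0) = 1`. In dimension
two the curvature of `φ g₀` satisfies `φ R = R₀ - Δ₀ log φ` (`scalarCurv_conformal`). The flow is
therefore the scalar equation `∂ₜφ = Δ₀ log φ - R₀`, and the prescribed boundary curvature becomes
the nonlinear Neumann condition `∂_η log φ = 2 k₀ (√φ - 1)` (`IsRicciFlow.gradient_boundary`).

Since `R₀ ≥ 0` and `k₀ ≤ 0`, the maximum principle gives `φ ≤ 1`. Comparing the solution with its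
own time translates then shows that `φ` is nonincreasing in time
(`IsRicciFlow.conformalFactor_antitone`). By the divergence theorem `∫ R dA` equals the constant `∫
R₀ dA₀` minus the boundary integral of `2 k₀ (√φ - 1)`. As `k₀ ≤ 0` and `φ` decreases, this integral
grows, so `S(t) = ∫ R dA` is nonincreasing (`IsRicciFlow.totalScalarCurv_antitone`).

Finally the area satisfies `A' = -S`, hence `t S(t) ≤ A(0) - A(t) ≤ A(0)`, a bound that involves
`g₀` alone. -/

namespace Cylinder

/-! ### Calculus of partial derivatives on the closed strip. -/

/-- Coordinate vectors of the strip. -/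
def coordVec (i : Fin 2) : ℝ × ℝ := if i = 0 then (1, 0) else (0, 1)

theorem mem_strip {ρ : ℝ} {p : ℝ × ℝ} : p ∈ strip ρ ↔ p.2 ∈ Icc (-ρ) ρ := by
  simp [strip]

theorem uniqueDiffOn_strip {ρ : ℝ} (hρ : 0 < ρ) : UniqueDiffOn ℝ (strip ρ) :=
  uniqueDiffOn_univ.prod (uniqueDiffOn_Icc (by linarith))

/-- Horizontal lines and vertical segments through `p` stay in the strip, so the chain rule applies
along both. This is the bridge by which the calculus rules below follow from those for Fréchet
derivatives, boundary points included. -/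
theorem pd_eq_of_hasFDerivWithinAt {ρ : ℝ} (hρ : 0 < ρ) {f : ℝ × ℝ → ℝ} {p : ℝ × ℝ}
    {f' : ℝ × ℝ →L[ℝ] ℝ} (hp : p ∈ strip ρ) (h : HasFDerivWithinAt f f' (strip ρ) p) (i : Fin 2) :
    pd ρ i f p = f' (coordVec i) := by
  have hp2 := mem_strip.1 hp
  fin_cases i
  · have hc : HasDerivWithinAt (fun θ : ℝ => (θ, p.2)) ((1, 0) : ℝ × ℝ) univ p.1 :=
      ((hasDerivAt_id p.1).prodMk (hasDerivAt_const p.1 p.2)).hasDerivWithinAt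
    have := HasFDerivWithinAt.comp_hasDerivWithinAt (t := strip ρ) p.1 h hc
      (fun θ _ => mem_strip.2 hp2)
    rw [hasDerivWithinAt_univ] at this
    simpa [pd, coordVec, Function.comp_def] using this.deriv
  · have hc : HasDerivWithinAt (fun s : ℝ => (p.1, s)) ((0, 1) : ℝ × ℝ) (Icc (-ρ) ρ) p.2 :=
      ((hasDerivAt_const p.2 p.1).prodMk (hasDerivAt_id p.2)).hasDerivWithinAt
    have := HasFDerivWithinAt.comp_hasDerivWithinAt (t := strip ρ) p.2 h hc
      (fun s hs => mem_strip.2 hs)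
    simpa [pd, coordVec, Function.comp_def] using this.derivWithin (uniqueDiffOn_Icc (by linarith) p.2 hp2)

/-- Smooth functions on the strip, up to the boundary. -/
abbrev Sm (ρ : ℝ) (f : ℝ × ℝ → ℝ) : Prop := ContDiffOn ℝ ∞ f (strip ρ)

theorem Sm.hasFDerivWithinAt {ρ : ℝ} {f : ℝ × ℝ → ℝ} (hf : Sm ρ f) {p : ℝ × ℝ}
    (hp : p ∈ strip ρ) : HasFDerivWithinAt f (fderivWithin ℝ f (strip ρ) p) (strip ρ) p :=
  (hf.differentiableOn (by simp) p hp).hasFDerivWithinAt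

theorem Sm.pd_eq {ρ : ℝ} (hρ : 0 < ρ) {f : ℝ × ℝ → ℝ} (hf : Sm ρ f) {p : ℝ × ℝ}
    (hp : p ∈ strip ρ) (i : Fin 2) : pd ρ i f p = fderivWithin ℝ f (strip ρ) p (coordVec i) :=
  pd_eq_of_hasFDerivWithinAt hρ hp (hf.hasFDerivWithinAt hp) i

theorem Sm.pd {ρ : ℝ} (hρ : 0 < ρ) {f : ℝ × ℝ → ℝ} (hf : Sm ρ f) (i : Fin 2) :
    Sm ρ (pd ρ i f) := by
  have h : ContDiffOn ℝ ∞ (fderivWithin ℝ f (strip ρ)) (strip ρ) :=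
    hf.fderivWithin (uniqueDiffOn_strip hρ) (by simp)
  exact (h.clm_apply contDiffOn_const).congr fun p hp => hf.pd_eq hρ hp i

theorem pd_congr {ρ : ℝ} {f h : ℝ × ℝ → ℝ} (hfh : ∀ p ∈ strip ρ, f p = h p)
    {p : ℝ × ℝ} (hp : p ∈ strip ρ) (i : Fin 2) : pd ρ i f p = pd ρ i h p := by
  have hp2 := mem_strip.1 hp
  unfold Cylinder.pd
  split_ifs
  · congr 1
    funext θ
    exact hfh _ (mem_strip.2 hp2)
  · exact derivWithin_congr (fun s hs => hfh _ (mem_strip.2 hs)) (hfh _ (mem_strip.2 hp2))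

theorem pd_add {ρ : ℝ} (hρ : 0 < ρ) {f h : ℝ × ℝ → ℝ} (hf : Sm ρ f) (hh : Sm ρ h) {p : ℝ × ℝ}
    (hp : p ∈ strip ρ) (i : Fin 2) :
    pd ρ i (fun q => f q + h q) p = pd ρ i f p + pd ρ i h p := by
  rw [hf.pd_eq hρ hp, hh.pd_eq hρ hp, pd_eq_of_hasFDerivWithinAt hρ hp
    ((hf.hasFDerivWithinAt hp).fun_add (hh.hasFDerivWithinAt hp))]
  rfl

theorem pd_sub {ρ : ℝ} (hρ : 0 < ρ) {f h : ℝ × ℝ → ℝ} (hf : Sm ρ f) (hh : Sm ρ h) {p : ℝ × ℝ}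
    (hp : p ∈ strip ρ) (i : Fin 2) :
    pd ρ i (fun q => f q - h q) p = pd ρ i f p - pd ρ i h p := by
  rw [hf.pd_eq hρ hp, hh.pd_eq hρ hp, pd_eq_of_hasFDerivWithinAt hρ hp
    ((hf.hasFDerivWithinAt hp).fun_sub (hh.hasFDerivWithinAt hp))]
  rfl

theorem pd_mul {ρ : ℝ} (hρ : 0 < ρ) {f h : ℝ × ℝ → ℝ} (hf : Sm ρ f) (hh : Sm ρ h) {p : ℝ × ℝ}
    (hp : p ∈ strip ρ) (i : Fin 2) :
    pd ρ i (fun q => f q * h q) p = f p * pd ρ i h p + h p * pd ρ i f p := by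
  rw [hf.pd_eq hρ hp, hh.pd_eq hρ hp, pd_eq_of_hasFDerivWithinAt hρ hp
    ((hf.hasFDerivWithinAt hp).fun_mul (hh.hasFDerivWithinAt hp))]
  simp

theorem pd_const_mul {ρ : ℝ} (hρ : 0 < ρ) {f : ℝ × ℝ → ℝ} (hf : Sm ρ f) (c : ℝ) {p : ℝ × ℝ}
    (hp : p ∈ strip ρ) (i : Fin 2) :
    pd ρ i (fun q => c * f q) p = c * pd ρ i f p := by
  rw [hf.pd_eq hρ hp, pd_eq_of_hasFDerivWithinAt hρ hp
    ((hf.hasFDerivWithinAt hp).const_mul c)]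
  simp

theorem pd_log {ρ : ℝ} (hρ : 0 < ρ) {f : ℝ × ℝ → ℝ} (hf : Sm ρ f) {p : ℝ × ℝ}
    (hp : p ∈ strip ρ) (h0 : f p ≠ 0) (i : Fin 2) :
    pd ρ i (fun q => Real.log (f q)) p = pd ρ i f p / f p := by
  rw [hf.pd_eq hρ hp, pd_eq_of_hasFDerivWithinAt hρ hp
    ((hf.hasFDerivWithinAt hp).log h0)]
  simp [div_eq_inv_mul]

theorem pd_sqrt {ρ : ℝ} (hρ : 0 < ρ) {f : ℝ × ℝ → ℝ} (hf : Sm ρ f) {p : ℝ × ℝ}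
    (hp : p ∈ strip ρ) (h0 : f p ≠ 0) (i : Fin 2) :
    pd ρ i (fun q => √(f q)) p = pd ρ i f p / (2 * √(f p)) := by
  rw [hf.pd_eq hρ hp, pd_eq_of_hasFDerivWithinAt hρ hp
    ((hf.hasFDerivWithinAt hp).sqrt h0)]
  simp [div_eq_inv_mul]

theorem interior_strip {ρ : ℝ} : interior (strip ρ) = univ ×ˢ Ioo (-ρ) ρ := by
  simp [strip, interior_prod_eq]

theorem strip_mem_nhds {ρ : ℝ} {p : ℝ × ℝ} (hp : p.2 ∈ Ioo (-ρ) ρ) : strip ρ ∈ nhds p := by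
  rw [mem_nhds_iff]
  exact ⟨univ ×ˢ Ioo (-ρ) ρ, prod_mono_right Ioo_subset_Icc_self, isOpen_univ.prod isOpen_Ioo,
    by simpa using hp⟩

theorem strip_subset_closure_interior {ρ : ℝ} (hρ : 0 < ρ) :
    strip ρ ⊆ closure (interior (strip ρ)) := by
  rw [interior_strip, closure_prod_eq, closure_Ioo (by linarith)]
  simp [strip]

/-- The symmetry persists at `s = ±ρ` because the strip lies in the closure of its interior. -/
theorem pd_comm {ρ : ℝ} (hρ : 0 < ρ) {f : ℝ × ℝ → ℝ} (hf : Sm ρ f) {p : ℝ × ℝ}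
    (hp : p ∈ strip ρ) (i j : Fin 2) : pd ρ i (pd ρ j f) p = pd ρ j (pd ρ i f) p := by
  have hU := uniqueDiffOn_strip hρ
  have hsymm : IsSymmSndFDerivWithinAt ℝ f (strip ρ) p :=
    (contDiffOn_infty.1 hf 2 p hp).isSymmSndFDerivWithinAt (by simp) hU (strip_subset_closure_interior hρ hp) hp
  have key : ∀ i j : Fin 2, pd ρ i (pd ρ j f) p =
      fderivWithin ℝ (fderivWithin ℝ f (strip ρ)) (strip ρ) p (coordVec i) (coordVec j) := by
    intro i j
    have h : ContDiffOn ℝ ∞ (fderivWithin ℝ f (strip ρ)) (strip ρ) :=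
      hf.fderivWithin hU (by simp)
    have h2 := (h.differentiableOn (by simp) p hp).hasFDerivWithinAt
    have h3 := h2.clm_apply (hasFDerivWithinAt_const (coordVec j) p (strip ρ))
    have h4 := h3.congr (fun q hq => hf.pd_eq hρ hq j) (hf.pd_eq hρ hp j)
    rw [pd_eq_of_hasFDerivWithinAt hρ hp h4]
    simp
  rw [key, key, hsymm]

theorem pd_periodic {ρ : ℝ} {f : ℝ × ℝ → ℝ} {c : ℝ}
    (hf : ∀ p ∈ strip ρ, f (p.1 + c, p.2) = f p) (i : Fin 2) {p : ℝ × ℝ} (hp : p ∈ strip ρ) :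
    pd ρ i f (p.1 + c, p.2) = pd ρ i f p := by
  have hp2 := mem_strip.1 hp
  unfold pd
  split_ifs
  · have := deriv_comp_add_const (fun θ => f (θ, p.2)) c p.1
    simp only [] at this ⊢
    rw [← this]
    congr 1
    funext θ
    exact hf (θ, p.2) (mem_strip.2 hp2)
  · exact derivWithin_congr (fun s hs => hf (p.1, s) (mem_strip.2 hs)) (hf p hp)

/-! ### Metric, gradient and Laplace–Beltrami operator. -/

section metric

variable {ρ : ℝ} {g : ℝ × ℝ → Matrix (Fin 2) (Fin 2) ℝ}

theorem IsMetric.symm (hg : IsMetric ρ g) {p : ℝ × ℝ} (hp : p ∈ strip ρ) :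
    g p 1 0 = g p 0 1 := by
  simpa using (hg.posDef p hp).isHermitian.apply 0 1

theorem IsMetric.pos_zero (hg : IsMetric ρ g) {p : ℝ × ℝ} (hp : p ∈ strip ρ) :
    0 < g p 0 0 := (hg.posDef p hp).diag_pos

theorem IsMetric.det_pos (hg : IsMetric ρ g) {p : ℝ × ℝ} (hp : p ∈ strip ρ) :
    0 < (g p).det := (hg.posDef p hp).det_pos

theorem inv_apply_fin_two (A : Matrix (Fin 2) (Fin 2) ℝ) :
    A⁻¹ 0 0 = A 1 1 / A.det ∧ A⁻¹ 0 1 = -A 0 1 / A.det ∧ A⁻¹ 1 0 = -A 1 0 / A.det ∧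
      A⁻¹ 1 1 = A 0 0 / A.det := by
  simp [Matrix.inv_def, Matrix.adjugate_fin_two, Ring.inverse_eq_inv', div_eq_inv_mul]

theorem IsMetric.inv_one_pos (hg : IsMetric ρ g) {p : ℝ × ℝ} (hp : p ∈ strip ρ) :
    0 < (g p)⁻¹ 1 1 := by
  rw [(inv_apply_fin_two _).2.2.2]
  exact div_pos (hg.pos_zero hp) (hg.det_pos hp)

theorem IsMetric.inv_symm (hg : IsMetric ρ g) {p : ℝ × ℝ} (hp : p ∈ strip ρ) :
    (g p)⁻¹ 1 0 = (g p)⁻¹ 0 1 := by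
  rw [(inv_apply_fin_two _).2.2.1, (inv_apply_fin_two _).2.1, hg.symm hp]

theorem IsMetric.sm_det (hg : IsMetric ρ g) : Sm ρ (fun p => (g p).det) := by
  simp only [Matrix.det_fin_two]
  exact ((hg.smooth 0 0).mul (hg.smooth 1 1)).sub ((hg.smooth 0 1).mul (hg.smooth 1 0))

theorem IsMetric.sm_inv (hg : IsMetric ρ g) (i j : Fin 2) : Sm ρ (fun p => (g p)⁻¹ i j) := by
  have hd : ∀ p ∈ strip ρ, (g p).det ≠ 0 := fun p hp => (hg.det_pos hp).ne'
  fin_cases i <;> fin_cases j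
  · simpa [inv_apply_fin_two] using (hg.smooth 1 1).fun_div hg.sm_det hd
  · simpa [inv_apply_fin_two] using (hg.smooth 0 1).neg.fun_div hg.sm_det hd
  · simpa [inv_apply_fin_two] using (hg.smooth 1 0).neg.fun_div hg.sm_det hd
  · simpa [inv_apply_fin_two] using (hg.smooth 0 0).fun_div hg.sm_det hd

theorem IsMetric.sm_christoffel (hρ : 0 < ρ) (hg : IsMetric ρ g) (k i j : Fin 2) :
    Sm ρ (christoffel ρ g k i j) := by
  unfold christoffel
  exact contDiffOn_const.mul (ContDiffOn.sum fun l _ => (hg.sm_inv k l).mul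
    (((Sm.pd hρ (hg.smooth j l) i).add (Sm.pd hρ (hg.smooth i l) j)).sub
      (Sm.pd hρ (hg.smooth i j) l)))

theorem IsMetric.sm_ricci (hρ : 0 < ρ) (hg : IsMetric ρ g) (i j : Fin 2) :
    Sm ρ (ricci ρ g i j) := by
  have h := hg.sm_christoffel hρ
  unfold ricci
  exact (ContDiffOn.sum fun k _ => ((h k i j).pd hρ k).sub ((h k i k).pd hρ j)).add
    (ContDiffOn.sum fun k _ => ContDiffOn.sum fun l _ =>
      ((h k k l).mul (h l i j)).sub ((h k j l).mul (h l i k)))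

theorem IsMetric.sm_scalarCurv (hρ : 0 < ρ) (hg : IsMetric ρ g) : Sm ρ (scalarCurv ρ g) := by
  unfold scalarCurv
  exact ContDiffOn.sum fun i _ => ContDiffOn.sum fun j _ =>
    (hg.sm_inv i j).mul (hg.sm_ricci hρ i j)

theorem IsMetric.sm_sqrt_det (hg : IsMetric ρ g) : Sm ρ (fun p => √(g p).det) :=
  hg.sm_det.sqrt fun _ hp => (hg.det_pos hp).ne'

/-- Components of the gradient of a function. -/
noncomputable def gradient (ρ : ℝ) (g : ℝ × ℝ → Matrix (Fin 2) (Fin 2) ℝ) (f : ℝ × ℝ → ℝ)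
    (k : Fin 2) (p : ℝ × ℝ) : ℝ :=
  ∑ l, (g p)⁻¹ k l * pd ρ l f p

/-- The Laplace–Beltrami operator `∂ₖ Vᵏ + Γˡₖₗ Vᵏ`, where `V` is the gradient. -/
noncomputable def laplacian (ρ : ℝ) (g : ℝ × ℝ → Matrix (Fin 2) (Fin 2) ℝ) (f : ℝ × ℝ → ℝ)
    (p : ℝ × ℝ) : ℝ :=
  ∑ k, (pd ρ k (gradient ρ g f k) p + (∑ l, christoffel ρ g l k l p) * gradient ρ g f k p)

theorem IsMetric.sm_gradient (hρ : 0 < ρ) (hg : IsMetric ρ g) {f : ℝ × ℝ → ℝ} (hf : Sm ρ f)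
    (k : Fin 2) : Sm ρ (gradient ρ g f k) := by
  unfold gradient
  exact ContDiffOn.sum fun l _ => (hg.sm_inv k l).mul (hf.pd hρ l)

theorem IsMetric.pd_eq_gradient (hg : IsMetric ρ g) {f : ℝ × ℝ → ℝ} {p : ℝ × ℝ}
    (hp : p ∈ strip ρ) (i : Fin 2) :
    pd ρ i f p = g p i 0 * gradient ρ g f 0 p + g p i 1 * gradient ρ g f 1 p := by
  have hd := (hg.det_pos hp).ne'
  have hdet := Matrix.det_fin_two (g p)
  rw [hg.symm hp] at hdet
  fin_cases i <;>
  · simp [gradient, Fin.sum_univ_two, inv_apply_fin_two, hg.symm hp]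
    field_simp
    rw [hdet]
    ring

theorem gradient_sub (hρ : 0 < ρ) {f h : ℝ × ℝ → ℝ} (hf : Sm ρ f) (hh : Sm ρ h)
    {p : ℝ × ℝ} (hp : p ∈ strip ρ) (k : Fin 2) :
    gradient ρ g (fun q => f q - h q) k p = gradient ρ g f k p - gradient ρ g h k p := by
  simp only [gradient, Fin.sum_univ_two, pd_sub hρ hf hh hp]
  ring

theorem IsMetric.laplacian_sub (hρ : 0 < ρ) (hg : IsMetric ρ g) {f h : ℝ × ℝ → ℝ} (hf : Sm ρ f)
    (hh : Sm ρ h) {p : ℝ × ℝ} (hp : p ∈ strip ρ) :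
    laplacian ρ g (fun q => f q - h q) p = laplacian ρ g f p - laplacian ρ g h p := by
  have h1 : ∀ k, pd ρ k (gradient ρ g (fun q => f q - h q) k) p =
      pd ρ k (gradient ρ g f k) p - pd ρ k (gradient ρ g h k) p := fun k => by
    rw [pd_congr (fun q hq => gradient_sub hρ hf hh hq k) hp,
      pd_sub hρ (hg.sm_gradient hρ hf k) (hg.sm_gradient hρ hh k) hp]
  simp only [laplacian, Fin.sum_univ_two, h1, gradient_sub hρ hf hh hp]
  ring

/-- The first-order coefficients of the Laplace–Beltrami operator. -/
noncomputable def laplacianDrift (ρ : ℝ) (g : ℝ × ℝ → Matrix (Fin 2) (Fin 2) ℝ) (l : Fin 2)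
    (p : ℝ × ℝ) : ℝ :=
  ∑ k, (pd ρ k (fun q => (g q)⁻¹ k l) p + (∑ m, christoffel ρ g m k m p) * (g p)⁻¹ k l)

theorem IsMetric.sm_laplacianDrift (hρ : 0 < ρ) (hg : IsMetric ρ g) (l : Fin 2) :
    Sm ρ (laplacianDrift ρ g l) := by
  unfold laplacianDrift
  exact ContDiffOn.sum fun k _ => ((hg.sm_inv k l).pd hρ k).add
    ((ContDiffOn.sum fun m _ => hg.sm_christoffel hρ m k m).mul (hg.sm_inv k l))

/-- The non-divergence form, in which the sign of the Laplacian at a maximum can be read off from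
the Hessian. -/
theorem IsMetric.laplacian_eq (hρ : 0 < ρ) (hg : IsMetric ρ g) {f : ℝ × ℝ → ℝ} (hf : Sm ρ f)
    {p : ℝ × ℝ} (hp : p ∈ strip ρ) :
    laplacian ρ g f p = (g p)⁻¹ 0 0 * pd ρ 0 (pd ρ 0 f) p + 2 * (g p)⁻¹ 0 1 * pd ρ 0 (pd ρ 1 f) p
      + (g p)⁻¹ 1 1 * pd ρ 1 (pd ρ 1 f) p
      + laplacianDrift ρ g 0 p * pd ρ 0 f p + laplacianDrift ρ g 1 p * pd ρ 1 f p := by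
  have h1 : ∀ k, pd ρ k (gradient ρ g f k) p =
      ((g p)⁻¹ k 0 * pd ρ k (pd ρ 0 f) p + pd ρ 0 f p * pd ρ k (fun q => (g q)⁻¹ k 0) p) +
      ((g p)⁻¹ k 1 * pd ρ k (pd ρ 1 f) p + pd ρ 1 f p * pd ρ k (fun q => (g q)⁻¹ k 1) p) :=
    fun k => by
    unfold gradient
    simp only [Fin.sum_univ_two]
    rw [pd_add hρ ((hg.sm_inv k 0).mul (hf.pd hρ 0)) ((hg.sm_inv k 1).mul (hf.pd hρ 1)) hp,
      pd_mul hρ (hg.sm_inv k 0) (hf.pd hρ 0) hp, pd_mul hρ (hg.sm_inv k 1) (hf.pd hρ 1) hp]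
  simp only [laplacian, Fin.sum_univ_two, h1, laplacianDrift, gradient, hg.inv_symm hp,
    pd_comm hρ hf hp 1 0]
  ring

theorem IsMetric.gradient_periodic (hg : IsMetric ρ g) {f : ℝ × ℝ → ℝ}
    (hf : ∀ p ∈ strip ρ, f (p.1 + 2 * Real.pi, p.2) = f p) {p : ℝ × ℝ} (hp : p ∈ strip ρ)
    (k : Fin 2) : gradient ρ g f k (p.1 + 2 * Real.pi, p.2) = gradient ρ g f k p := by
  simp only [gradient, hg.periodic p hp, pd_periodic hf _ hp]

/-- Jacobi's formula: the trace of the Christoffel symbols is the logarithmic derivative of `√det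
g`. It turns the covariant divergence into a coordinate divergence. -/
theorem IsMetric.pd_det (hρ : 0 < ρ) (hg : IsMetric ρ g) {p : ℝ × ℝ} (hp : p ∈ strip ρ)
    (k : Fin 2) :
    pd ρ k (fun q => (g q).det) p = 2 * (g p).det * ∑ l, christoffel ρ g l k l p := by
  have hd := (hg.det_pos hp).ne'
  have h10 : ∀ k, pd ρ k (fun q => g q 1 0) p = pd ρ k (fun q => g q 0 1) p :=
    fun k => pd_congr (fun q hq => hg.symm hq) hp k
  have h : pd ρ k (fun q => (g q).det) p =
      (g p 0 0 * pd ρ k (fun q => g q 1 1) p + g p 1 1 * pd ρ k (fun q => g q 0 0) p) -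
      (g p 0 1 * pd ρ k (fun q => g q 1 0) p + g p 1 0 * pd ρ k (fun q => g q 0 1) p) := by
    simp only [Matrix.det_fin_two]
    rw [pd_sub hρ ((hg.smooth 0 0).mul (hg.smooth 1 1)) ((hg.smooth 0 1).mul (hg.smooth 1 0)) hp,
      pd_mul hρ (hg.smooth 0 0) (hg.smooth 1 1) hp, pd_mul hρ (hg.smooth 0 1) (hg.smooth 1 0) hp]
  rw [h]
  fin_cases k <;>
  · simp only [christoffel, Fin.sum_univ_two, inv_apply_fin_two, h10, hg.symm hp, Fin.zero_eta,
      Fin.mk_one]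
    field_simp
    ring

/-- The Laplace–Beltrami operator in divergence form. -/
theorem IsMetric.divergence_form (hρ : 0 < ρ) (hg : IsMetric ρ g) {f : ℝ × ℝ → ℝ} (hf : Sm ρ f)
    {p : ℝ × ℝ} (hp : p ∈ strip ρ) :
    pd ρ 0 (fun q => √(g q).det * gradient ρ g f 0 q) p +
      pd ρ 1 (fun q => √(g q).det * gradient ρ g f 1 q) p =
      √(g p).det * laplacian ρ g f p := by
  have hd := hg.det_pos hp
  have hs : √(g p).det ≠ 0 := (Real.sqrt_pos.2 hd).ne'
  have hsq : √(g p).det ^ 2 = (g p).det := Real.sq_sqrt hd.le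
  have h : ∀ k, pd ρ k (fun q => √(g q).det) p =
      √(g p).det * ∑ l, christoffel ρ g l k l p := fun k => by
    rw [pd_sqrt hρ hg.sm_det hp hd.ne', hg.pd_det hρ hp, div_eq_iff (by positivity)]
    linear_combination (-2 * ∑ l, christoffel ρ g l k l p) * hsq
  rw [pd_mul hρ hg.sm_sqrt_det (hg.sm_gradient hρ hf 0) hp,
    pd_mul hρ hg.sm_sqrt_det (hg.sm_gradient hρ hf 1) hp, h, h]
  simp only [laplacian, Fin.sum_univ_two]
  ring

end metric

/-! ### Curvature under a conformal change of metric. -/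

section conformal

variable {ρ : ℝ} {g₀ g : ℝ × ℝ → Matrix (Fin 2) (Fin 2) ℝ} {φ : ℝ × ℝ → ℝ}

/-- The difference of the Christoffel symbols of `e^v g` and of `g`. -/
noncomputable def conformalChange (ρ : ℝ) (g : ℝ × ℝ → Matrix (Fin 2) (Fin 2) ℝ) (v : ℝ × ℝ → ℝ)
    (k i j : Fin 2) (p : ℝ × ℝ) : ℝ :=
  (1 / 2) * ((if k = j then pd ρ i v p else 0) + (if k = i then pd ρ j v p else 0)
    - g p i j * gradient ρ g v k p)

theorem sm_ite_zero {f : ℝ × ℝ → ℝ} (hf : Sm ρ f) (P : Prop) [Decidable P] :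
    Sm ρ (fun p => if P then f p else 0) := by
  split_ifs
  exacts [hf, contDiffOn_const]

theorem sm_conformalChange (hρ : 0 < ρ) (hg : IsMetric ρ g) {v : ℝ × ℝ → ℝ} (hv : Sm ρ v)
    (k i j : Fin 2) : Sm ρ (conformalChange ρ g v k i j) := by
  unfold conformalChange
  exact contDiffOn_const.mul (((sm_ite_zero (hv.pd hρ i) _).add (sm_ite_zero (hv.pd hρ j) _)).sub
    ((hg.smooth i j).mul (hg.sm_gradient hρ hv k)))

theorem pd_ite_zero {f : ℝ × ℝ → ℝ} (P : Prop) [Decidable P] (i : Fin 2) (p : ℝ × ℝ) :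
    pd ρ i (fun q => if P then f q else 0) p = if P then pd ρ i f p else 0 := by
  split_ifs
  · rfl
  · simp [pd]

theorem pd_conformalChange (hρ : 0 < ρ) (hg : IsMetric ρ g) {v : ℝ × ℝ → ℝ} (hv : Sm ρ v)
    (m k i j : Fin 2) {p : ℝ × ℝ} (hp : p ∈ strip ρ) :
    pd ρ m (conformalChange ρ g v k i j) p =
      (1 / 2) * ((if k = j then pd ρ m (pd ρ i v) p else 0)
        + (if k = i then pd ρ m (pd ρ j v) p else 0)
        - (g p i j * pd ρ m (gradient ρ g v k) p
          + gradient ρ g v k p * pd ρ m (fun q => g q i j) p)) := by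
  have h1 := sm_ite_zero (hv.pd hρ i) (k = j)
  have h2 := sm_ite_zero (hv.pd hρ j) (k = i)
  have h3 := (hg.smooth i j).mul (hg.sm_gradient hρ hv k)
  unfold conformalChange
  rw [pd_const_mul hρ ((h1.add h2).sub h3) _ hp, pd_sub hρ (h1.add h2) h3 hp, pd_add hρ h1 h2 hp,
    pd_mul hρ (hg.smooth i j) (hg.sm_gradient hρ hv k) hp, pd_ite_zero, pd_ite_zero]

theorem inv_smul_fin_two {c : ℝ} (hc : c ≠ 0) (A : Matrix (Fin 2) (Fin 2) ℝ) (i j : Fin 2) :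
    (c • A)⁻¹ i j = A⁻¹ i j / c := by
  by_cases hd : A.det = 0
  · fin_cases i <;> fin_cases j <;> simp [inv_apply_fin_two, hd]
  · fin_cases i <;> fin_cases j <;> simp [inv_apply_fin_two] <;> field_simp

theorem christoffel_conformal (hρ : 0 < ρ) (hg₀ : IsMetric ρ g₀) (hφ : Sm ρ φ)
    (hpos : ∀ p ∈ strip ρ, 0 < φ p) (hg : ∀ p ∈ strip ρ, g p = φ p • g₀ p)
    {p : ℝ × ℝ} (hp : p ∈ strip ρ) (k i j : Fin 2) :
    christoffel ρ g k i j p = christoffel ρ g₀ k i j p +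
      conformalChange ρ g₀ (fun q => Real.log (φ q)) k i j p := by
  have h0 := (hpos p hp).ne'
  have hd := (hg₀.det_pos hp).ne'
  have hpd : ∀ m i j, pd ρ m (fun q => g q i j) p =
      φ p * pd ρ m (fun q => g₀ q i j) p + g₀ p i j * pd ρ m φ p := fun m i j => by
    rw [← pd_mul hρ hφ (hg₀.smooth i j) hp]
    exact pd_congr (fun q hq => by simp [hg q hq]) hp m
  have h10 : ∀ m, pd ρ m (fun q => g₀ q 1 0) p = pd ρ m (fun q => g₀ q 0 1) p :=
    fun m => pd_congr (fun q hq => hg₀.symm hq) hp m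
  have hdet := Matrix.det_fin_two (g₀ p)
  rw [hg₀.symm hp] at hdet
  fin_cases k <;> fin_cases i <;> fin_cases j <;>
  · simp [christoffel, conformalChange, gradient, Fin.sum_univ_two, hpd, hg p hp,
      inv_smul_fin_two h0, pd_log hρ hφ hp h0, inv_apply_fin_two, hg₀.symm hp, h10]
    field_simp
    try rw [hdet]
    ring

/-- Insert the changed Christoffel symbols into the Ricci tensor and trace. In dimension two the
terms quadratic in the gradient of `log φ` cancel, which leaves only the Laplacian. -/
theorem scalarCurv_conformal (hρ : 0 < ρ) (hg₀ : IsMetric ρ g₀) (hφ : Sm ρ φ)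
    (hpos : ∀ p ∈ strip ρ, 0 < φ p) (hg : ∀ p ∈ strip ρ, g p = φ p • g₀ p)
    {p : ℝ × ℝ} (hp : p ∈ strip ρ) :
    φ p * scalarCurv ρ g p =
      scalarCurv ρ g₀ p - laplacian ρ g₀ (fun q => Real.log (φ q)) p := by
  have h0 := (hpos p hp).ne'
  have hd := (hg₀.det_pos hp).ne'
  have hv : Sm ρ (fun q => Real.log (φ q)) := hφ.log fun q hq => (hpos q hq).ne'
  have hΓ := fun k i j => christoffel_conformal hρ hg₀ hφ hpos hg hp k i j
  have hdΓ : ∀ m k i j, pd ρ m (christoffel ρ g k i j) p = pd ρ m (christoffel ρ g₀ k i j) p +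
      pd ρ m (conformalChange ρ g₀ (fun q => Real.log (φ q)) k i j) p := fun m k i j => by
    rw [← pd_add hρ (hg₀.sm_christoffel hρ k i j) (sm_conformalChange hρ hg₀ hv k i j) hp]
    exact pd_congr (fun q hq => christoffel_conformal hρ hg₀ hφ hpos hg hq k i j) hp m
  have hdC := fun m k i j => pd_conformalChange hρ hg₀ hv m k i j hp
  set v := fun q => Real.log (φ q) with hvdef
  have h10 : ∀ m, pd ρ m (fun q => g₀ q 1 0) p = pd ρ m (fun q => g₀ q 0 1) p :=
    fun m => pd_congr (fun q hq => hg₀.symm hq) hp m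
  have hdet := Matrix.det_fin_two (g₀ p)
  rw [hg₀.symm hp] at hdet
  have hlow : ∀ i, pd ρ i v p = g₀ p i 0 * gradient ρ g₀ v 0 p + g₀ p i 1 * gradient ρ g₀ v 1 p :=
    fun i => hg₀.pd_eq_gradient hp i
  -- Second derivatives of `v` are rewritten through derivatives of the gradient components, the
  -- unknowns that already occur in `pd_conformalChange` and in the Laplacian. No derivative of the
  -- inverse matrix then appears and the claim is a rational identity.
  have hhess : ∀ m i, pd ρ m (pd ρ i v) p =
      (g₀ p i 0 * pd ρ m (gradient ρ g₀ v 0) p +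
        gradient ρ g₀ v 0 p * pd ρ m (fun q => g₀ q i 0) p) +
      (g₀ p i 1 * pd ρ m (gradient ρ g₀ v 1) p +
        gradient ρ g₀ v 1 p * pd ρ m (fun q => g₀ q i 1) p) := fun m i => by
    have hV := hg₀.sm_gradient hρ hv
    rw [pd_congr (fun q hq => hg₀.pd_eq_gradient hq i) hp,
      pd_add hρ ((hg₀.smooth i 0).mul (hV 0)) ((hg₀.smooth i 1).mul (hV 1)) hp,
      pd_mul hρ (hg₀.smooth i 0) (hV 0) hp, pd_mul hρ (hg₀.smooth i 1) (hV 1) hp]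
  have key : ∑ i, ∑ j, (g₀ p)⁻¹ i j * (ricci ρ g i j p - ricci ρ g₀ i j p) =
      -laplacian ρ g₀ v p := by
    simp only [ricci, hΓ, hdΓ, hdC, laplacian, Fin.sum_univ_two, conformalChange, hlow, h10,
      hg₀.symm hp, Fin.isValue, zero_ne_one, one_ne_zero, if_true, if_false, hhess]
    generalize gradient ρ g₀ v 0 = V0
    generalize gradient ρ g₀ v 1 = V1
    simp only [christoffel, Fin.sum_univ_two, inv_apply_fin_two, h10, hg₀.symm hp]
    field_simp
    rw [hdet]
    ring
  have : scalarCurv ρ g p = (∑ i, ∑ j, (g₀ p)⁻¹ i j * ricci ρ g i j p) / φ p := by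
    simp only [scalarCurv, hg p hp, inv_smul_fin_two h0, Fin.sum_univ_two]
    ring
  rw [this, mul_div_cancel₀ _ h0, sub_eq_add_neg, ← key]
  simp only [scalarCurv, Fin.sum_univ_two]
  ring

/-- The unit normal scales by `φ^(-1/2)`, and its dual covector is a multiple of `ds`. Hence only
the symbol `Γ¹₀₀` enters, and its conformal change is a multiple of the `s`-component of the
gradient of `log φ`. -/
theorem geodesicCurv_conformal (hρ : 0 < ρ) (hg₀ : IsMetric ρ g₀) (hφ : Sm ρ φ)
    (hpos : ∀ p ∈ strip ρ, 0 < φ p) (hg : ∀ p ∈ strip ρ, g p = φ p • g₀ p)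
    {p : ℝ × ℝ} (hp : p ∈ strip ρ) :
    √(φ p) * geodesicCurv ρ g p = geodesicCurv ρ g₀ p +
      1 / 2 * (SignType.sign p.2 * gradient ρ g₀ (fun q => Real.log (φ q)) 1 p /
        √((g₀ p)⁻¹ 1 1)) := by
  have h0 := hpos p hp
  have hd := (hg₀.det_pos hp).ne'
  have hE := (hg₀.pos_zero hp).ne'
  have hs : √(φ p) ≠ 0 := (Real.sqrt_pos.2 h0).ne'
  have hs2 : φ p = √(φ p) ^ 2 := (Real.sq_sqrt h0.le).symm
  have hi : √((g₀ p)⁻¹ 1 1) ≠ 0 := (Real.sqrt_pos.2 (hg₀.inv_one_pos hp)).ne'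
  have hη : ∀ l, outwardNormal g p l = outwardNormal g₀ p l / √(φ p) := fun l => by
    simp only [outwardNormal, hg p hp, inv_smul_fin_two h0.ne', Real.sqrt_div' _ h0.le]
    field_simp
    rw [← hs2]
  have hn : ∀ k, ∑ l, g₀ p k l * outwardNormal g₀ p l =
      if k = 1 then SignType.sign p.2 / √((g₀ p)⁻¹ 1 1) else 0 := fun k => by
    have hdet := Matrix.det_fin_two (g₀ p)
    rw [hg₀.symm hp] at hdet
    have h1 : ∑ l, g₀ p k l * (g₀ p)⁻¹ l 1 = if k = 1 then 1 else 0 := by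
      fin_cases k
      · simp [Fin.sum_univ_two, inv_apply_fin_two]
        field_simp
        ring
      · simp [Fin.sum_univ_two, inv_apply_fin_two, hg₀.symm hp]
        field_simp
        rw [hdet]
        ring
    have h2 : ∑ l, g₀ p k l * outwardNormal g₀ p l =
        (∑ l, g₀ p k l * (g₀ p)⁻¹ l 1) * SignType.sign p.2 / √((g₀ p)⁻¹ 1 1) := by
      simp only [outwardNormal, Fin.sum_univ_two]
      ring
    rw [h2, h1]
    split_ifs <;> simp
  have h1 := hn 0
  have h2 := hn 1
  simp only [Fin.sum_univ_two, Fin.isValue, zero_ne_one, if_false, if_true] at h1 h2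
  set v := fun q => Real.log (φ q) with hvdef
  have e1 : geodesicCurv ρ g₀ p =
      -(christoffel ρ g₀ 1 0 0 p * (SignType.sign p.2 / √((g₀ p)⁻¹ 1 1))) / g₀ p 0 0 := by
    simp only [geodesicCurv, Fin.sum_univ_two]
    rw [← h2]
    linear_combination (-christoffel ρ g₀ 0 0 0 p / g₀ p 0 0) * h1
  have e2 : geodesicCurv ρ g p =
      -(christoffel ρ g 1 0 0 p * (SignType.sign p.2 / √((g₀ p)⁻¹ 1 1))) /
        (√(φ p) * g₀ p 0 0) := by
    simp only [geodesicCurv, Fin.sum_univ_two, hη, hg p hp, Matrix.smul_apply, smul_eq_mul]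
    rw [← h2]
    field_simp
    linear_combination (-christoffel ρ g 0 0 0 p) * h1
  rw [e1, e2, christoffel_conformal hρ hg₀ hφ hpos hg hp]
  simp only [conformalChange, Fin.isValue, one_ne_zero, if_false]
  field_simp
  ring

end conformal

/-! ### First and second order conditions at a spatial maximum, and the barrier. -/

theorem deriv2_nonpos_of_isLocalMax {h h' : ℝ → ℝ} {h'' x : ℝ} (hmax : IsLocalMax h x)
    (h1 : ∀ᶠ y in nhds x, HasDerivAt h (h' y) y) (h2 : HasDerivAt h' h'' x) : h'' ≤ 0 := by
  by_contra! hpos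
  have e1 : deriv h =ᶠ[nhds x] h' := h1.mono fun y hy => hy.deriv
  have e2 : deriv (deriv h) x = h'' := by rw [e1.deriv_eq, h2.deriv]
  have hmin := isLocalMin_of_deriv_deriv_pos (f := h) (x₀ := x) (by rwa [e2])
    hmax.deriv_eq_zero h1.self_of_nhds.continuousAt
  -- A positive second derivative would make `x` a local minimum as well, so `h` would be locally
  -- constant and its second derivative zero.
  have hconst : h =ᶠ[nhds x] fun _ => h x := by
    filter_upwards [hmax, hmin] with y a b using le_antisymm a b
  have e3 : deriv h =ᶠ[nhds x] fun _ => 0 := by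
    filter_upwards [hconst.eventuallyEq_nhds] with y hy
    rw [hy.deriv_eq]
    simp
  rw [e3.deriv_eq] at e2
  simp at e2
  linarith

section

variable {ρ : ℝ} {f : ℝ × ℝ → ℝ} {p : ℝ × ℝ}

theorem fderivWithin_sub_nonpos (hf : Sm ρ f) (hp : p ∈ strip ρ)
    (hmax : ∀ q ∈ strip ρ, f q ≤ f p) {q : ℝ × ℝ} (hq : q ∈ strip ρ) :
    fderivWithin ℝ f (strip ρ) p (q - p) ≤ 0 := by
  have hconv : Convex ℝ (strip ρ) := convex_univ.prod (convex_Icc _ _)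
  have hm : IsMaxOn f (strip ρ) p := fun q hq => hmax q hq
  exact hm.localize.hasFDerivWithinAt_nonpos (hf.hasFDerivWithinAt hp)
    (sub_mem_posTangentConeAt_of_segment_subset (hconv.segment_subset hp hq))

theorem pd_zero_eq_zero_of_max (hρ : 0 < ρ) (hf : Sm ρ f) (hp : p ∈ strip ρ)
    (hmax : ∀ q ∈ strip ρ, f q ≤ f p) : pd ρ 0 f p = 0 := by
  have hp2 := mem_strip.1 hp
  have h1 := fderivWithin_sub_nonpos hf hp hmax (q := p + (1, 0)) (mem_strip.2 (by simpa using hp2))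
  have h2 := fderivWithin_sub_nonpos hf hp hmax (q := p - (1, 0)) (mem_strip.2 (by simpa using hp2))
  have e : p - (1, 0) - p = -((1, 0) : ℝ × ℝ) := by abel
  rw [add_sub_cancel_left] at h1
  rw [e, map_neg] at h2
  rw [hf.pd_eq hρ hp]
  simp only [coordVec, if_true]
  linarith

/-- One-sided by design: choosing `s` on both sides of an interior point makes the derivative
vanish, while at a boundary point it still fixes the sign of the derivative. -/
theorem sub_mul_pd_one_nonpos_of_max (hρ : 0 < ρ) (hf : Sm ρ f) (hp : p ∈ strip ρ)
    (hmax : ∀ q ∈ strip ρ, f q ≤ f p) {s : ℝ} (hs : s ∈ Icc (-ρ) ρ) :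
    (s - p.2) * pd ρ 1 f p ≤ 0 := by
  have h1 := fderivWithin_sub_nonpos hf hp hmax (q := (p.1, s)) (mem_strip.2 hs)
  have e : ((p.1, s) : ℝ × ℝ) - p = (s - p.2) • coordVec 1 := by
    ext <;> simp [coordVec]
  rw [e, map_smul, smul_eq_mul] at h1
  rwa [hf.pd_eq hρ hp]

theorem pd_one_eq_zero_of_max (hρ : 0 < ρ) (hf : Sm ρ f) (hp : p.2 ∈ Ioo (-ρ) ρ)
    (hmax : ∀ q ∈ strip ρ, f q ≤ f p) : pd ρ 1 f p = 0 := by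
  have hp' : p ∈ strip ρ := mem_strip.2 (Ioo_subset_Icc_self hp)
  have h1 := sub_mul_pd_one_nonpos_of_max hρ hf hp' hmax (s := ρ) ⟨by linarith, le_rfl⟩
  have h2 := sub_mul_pd_one_nonpos_of_max hρ hf hp' hmax (s := -ρ) ⟨le_rfl, by linarith⟩
  apply le_antisymm <;> by_contra! h <;> nlinarith [hp.1, hp.2]

theorem Sm.hasFDerivAt (hf : Sm ρ f) (hp : p.2 ∈ Ioo (-ρ) ρ) :
    HasFDerivAt f (fderivWithin ℝ f (strip ρ) p) p :=
  (hf.hasFDerivWithinAt (mem_strip.2 (Ioo_subset_Icc_self hp))).hasFDerivAt (strip_mem_nhds hp)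

theorem map_coordVec (L : ℝ × ℝ →L[ℝ] ℝ) (x y : ℝ) :
    L (x, y) = x * L (coordVec 0) + y * L (coordVec 1) := by
  rw [← smul_eq_mul, ← smul_eq_mul, ← map_smul, ← map_smul, ← map_add]
  congr 1
  simp [coordVec]

theorem Sm.hasDerivAt_line (hρ : 0 < ρ) (hf : Sm ρ f) {x y τ : ℝ}
    (hp : p.2 + τ * y ∈ Ioo (-ρ) ρ) :
    HasDerivAt (fun τ : ℝ => f (p.1 + τ * x, p.2 + τ * y))
      (x * Cylinder.pd ρ 0 f (p.1 + τ * x, p.2 + τ * y) +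
        y * Cylinder.pd ρ 1 f (p.1 + τ * x, p.2 + τ * y)) τ := by
  have hl : HasDerivAt (fun τ : ℝ => (p.1 + τ * x, p.2 + τ * y)) (x, y) τ := by
    have h1 := ((hasDerivAt_id τ).mul_const x).const_add p.1
    have h2 := ((hasDerivAt_id τ).mul_const y).const_add p.2
    simpa using h1.prodMk h2
  have hq : (p.1 + τ * x, p.2 + τ * y) ∈ strip ρ := mem_strip.2 (Ioo_subset_Icc_self hp)
  have := (hf.hasFDerivAt (p := (p.1 + τ * x, p.2 + τ * y)) hp).comp_hasDerivAt τ hl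
  refine this.congr_deriv ?_
  rw [hf.pd_eq hρ hq, hf.pd_eq hρ hq, ← map_coordVec]

theorem hessian_nonpos_of_max (hρ : 0 < ρ) (hf : Sm ρ f) (hp : p.2 ∈ Ioo (-ρ) ρ)
    (hmax : ∀ q ∈ strip ρ, f q ≤ f p) (x y : ℝ) :
    x ^ 2 * pd ρ 0 (pd ρ 0 f) p + 2 * x * y * pd ρ 0 (pd ρ 1 f) p + y ^ 2 * pd ρ 1 (pd ρ 1 f) p
      ≤ 0 := by
  have hev : ∀ᶠ τ : ℝ in nhds 0, p.2 + τ * y ∈ Ioo (-ρ) ρ := by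
    have hc : ContinuousAt (fun τ : ℝ => p.2 + τ * y) 0 := by fun_prop
    exact hc.eventually_mem (isOpen_Ioo.mem_nhds (by simpa using hp))
  have h0 : p.2 + 0 * y ∈ Ioo (-ρ) ρ := by simpa using hp
  have h1 := hev.mono fun τ hτ => hf.hasDerivAt_line hρ (x := x) hτ
  have h2 := (((hf.pd hρ 0).hasDerivAt_line hρ (p := p) (x := x) h0).const_mul x).fun_add
    (((hf.pd hρ 1).hasDerivAt_line hρ (p := p) (x := x) h0).const_mul y)
  have hm : IsLocalMax (fun τ : ℝ => f (p.1 + τ * x, p.2 + τ * y)) 0 := by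
    filter_upwards [hev] with τ hτ
    simpa using hmax _ (mem_strip.2 (Ioo_subset_Icc_self hτ))
  have := deriv2_nonpos_of_isLocalMax hm h1 h2
  simp only [zero_mul, add_zero, Prod.mk.eta] at this
  rw [pd_comm hρ hf (mem_strip.2 (Ioo_subset_Icc_self hp)) 1 0] at this
  linarith

theorem IsMetric.laplacian_nonpos_of_max (hρ : 0 < ρ) {g : ℝ × ℝ → Matrix (Fin 2) (Fin 2) ℝ}
    (hg : IsMetric ρ g) (hf : Sm ρ f) (hp : p.2 ∈ Ioo (-ρ) ρ)
    (hmax : ∀ q ∈ strip ρ, f q ≤ f p) : laplacian ρ g f p ≤ 0 := by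
  have hp' : p ∈ strip ρ := mem_strip.2 (Ioo_subset_Icc_self hp)
  rw [hg.laplacian_eq hρ hf hp', pd_zero_eq_zero_of_max hρ hf hp' hmax,
    pd_one_eq_zero_of_max hρ hf hp hmax]
  have hd := hg.det_pos hp'
  have hE := hg.pos_zero hp'
  have hdet := Matrix.det_fin_two (g p)
  rw [hg.symm hp'] at hdet
  -- With `ξ = (-g₀₁, g₀₀)` and `e = (1, 0)`, the inverse metric is `(ξ ⊗ ξ + det g · e ⊗ e) / (det
  -- g · g₀₀)`. The trace of the Hessian is thus a positive combination of its values on these two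
  -- vectors.
  have h1 := hessian_nonpos_of_max hρ hf hp hmax (-g p 0 1) (g p 0 0)
  have h2 := hessian_nonpos_of_max hρ hf hp hmax 1 0
  simp only [inv_apply_fin_two]
  set H00 := pd ρ 0 (pd ρ 0 f) p
  set H01 := pd ρ 0 (pd ρ 1 f) p
  set H11 := pd ρ 1 (pd ρ 1 f) p
  have h3 : (g p).det * H00 ≤ 0 := mul_nonpos_of_nonneg_of_nonpos hd.le (by linarith)
  have e : g p 1 1 / (g p).det * H00 + 2 * (-g p 0 1 / (g p).det) * H01 +
      g p 0 0 / (g p).det * H11 + laplacianDrift ρ g 0 p * 0 + laplacianDrift ρ g 1 p * 0 =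
      (((-g p 0 1) ^ 2 * H00 + 2 * (-g p 0 1) * g p 0 0 * H01 + (g p 0 0) ^ 2 * H11) +
        (g p).det * H00) / ((g p).det * g p 0 0) := by
    field_simp
    rw [hdet]
    ring
  rw [e]
  exact div_nonpos_of_nonpos_of_nonneg (by linarith) (by positivity)

theorem gradient_const_mul (hρ : 0 < ρ) {g : ℝ × ℝ → Matrix (Fin 2) (Fin 2) ℝ} (hf : Sm ρ f)
    (c : ℝ) (hp : p ∈ strip ρ) (k : Fin 2) :
    gradient ρ g (fun q => c * f q) k p = c * gradient ρ g f k p := by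
  simp only [gradient, Fin.sum_univ_two, pd_const_mul hρ hf c hp]
  ring

theorem IsMetric.laplacian_const_mul (hρ : 0 < ρ) {g : ℝ × ℝ → Matrix (Fin 2) (Fin 2) ℝ}
    (hg : IsMetric ρ g) (hf : Sm ρ f) (c : ℝ) (hp : p ∈ strip ρ) :
    laplacian ρ g (fun q => c * f q) p = c * laplacian ρ g f p := by
  have h1 : ∀ k, pd ρ k (gradient ρ g (fun q => c * f q) k) p =
      c * pd ρ k (gradient ρ g f k) p := fun k => by
    rw [pd_congr (fun q hq => gradient_const_mul hρ hf c hq k) hp,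
      pd_const_mul hρ (hg.sm_gradient hρ hf k) c hp]
  simp only [laplacian, Fin.sum_univ_two, h1, gradient_const_mul hρ hf c hp]
  ring

/-- The barrier of the maximum principle: it is at least `1`, and its outward derivative is strictly
positive on both boundary components. -/
theorem sm_one_add_sq : Sm ρ (fun q => 1 + q.2 ^ 2) := by
  apply ContDiff.contDiffOn
  fun_prop

theorem pd_one_add_sq (hρ : 0 < ρ) (hp : p ∈ strip ρ) (i : Fin 2) :
    pd ρ i (fun q => 1 + q.2 ^ 2) p = if i = 0 then 0 else 2 * p.2 := by
  have h : HasFDerivWithinAt (fun q : ℝ × ℝ => 1 + q.2 ^ 2)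
      ((2 * p.2 ^ 1) • ContinuousLinearMap.snd ℝ ℝ ℝ) (strip ρ) p := by
    have := (((hasFDerivAt_snd (𝕜 := ℝ) (p := p)).pow 2).const_add 1).hasFDerivWithinAt
      (s := strip ρ)
    simpa using this
  rw [pd_eq_of_hasFDerivWithinAt hρ hp h]
  fin_cases i <;> simp [coordVec]

theorem IsMetric.laplacian_one_add_sq (hρ : 0 < ρ) {g : ℝ × ℝ → Matrix (Fin 2) (Fin 2) ℝ}
    (hg : IsMetric ρ g) (hp : p ∈ strip ρ) :
    laplacian ρ g (fun q => 1 + q.2 ^ 2) p =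
      2 * (g p)⁻¹ 1 1 + 2 * p.2 * laplacianDrift ρ g 1 p := by
  have e1 : ∀ k, pd ρ k (fun q : ℝ × ℝ => 2 * q.2) p = if k = 0 then 0 else 2 := fun k => by
    have h : HasFDerivWithinAt (fun q : ℝ × ℝ => 2 * q.2)
        ((2 : ℝ) • ContinuousLinearMap.snd ℝ ℝ ℝ) (strip ρ) p :=
      ((hasFDerivAt_snd (𝕜 := ℝ) (p := p)).const_mul (2 : ℝ)).hasFDerivWithinAt
    rw [pd_eq_of_hasFDerivWithinAt hρ hp h]
    fin_cases k <;> simp [coordVec]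
  have e2 : ∀ k, pd ρ k (pd ρ 1 fun q => 1 + q.2 ^ 2) p = if k = 0 then 0 else 2 := fun k => by
    rw [← e1]
    exact pd_congr (fun q hq => by simp [pd_one_add_sq hρ hq]) hp k
  have e3 : pd ρ 0 (pd ρ 0 fun q => 1 + q.2 ^ 2) p = 0 := by
    rw [pd_congr (h := fun _ => 0) (fun q hq => by simp [pd_one_add_sq hρ hq]) hp]
    simp [pd]
  rw [hg.laplacian_eq hρ sm_one_add_sq hp]
  simp [e2, e3, pd_one_add_sq hρ hp]
  ring

end

/-! ### Parabolic maximum principle. -/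

/-- A fundamental domain of the cylinder. -/
def fundDomain (ρ : ℝ) : Set (ℝ × ℝ) := Icc 0 (2 * Real.pi) ×ˢ Icc (-ρ) ρ

theorem fundDomain_subset {ρ : ℝ} : fundDomain ρ ⊆ strip ρ := prod_mono_left (subset_univ _)

theorem isCompact_fundDomain {ρ : ℝ} : IsCompact (fundDomain ρ) := isCompact_Icc.prod isCompact_Icc

theorem exists_mem_fundDomain {ρ : ℝ} {p : ℝ × ℝ} (hp : p ∈ strip ρ) {f : ℝ × ℝ → ℝ}
    (hf : ∀ p ∈ strip ρ, f (p.1 + 2 * Real.pi, p.2) = f p) :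
    ∃ q ∈ fundDomain ρ, f q = f p := by
  have hper : Function.Periodic (fun θ => f (θ, p.2)) (2 * Real.pi) := fun θ =>
    hf (θ, p.2) (mem_strip.2 (mem_strip.1 hp))
  obtain ⟨y, hy, hy'⟩ := hper.exists_mem_Ico₀ Real.two_pi_pos p.1
  exact ⟨(y, p.2), ⟨Ico_subset_Icc_self hy, mem_strip.1 hp⟩, hy'.symm⟩

/-- Weak parabolic maximum principle with a Neumann-type sign condition at the boundary. -/
theorem maximum_principle {ρ : ℝ} (hρ : 0 < ρ) {g : ℝ × ℝ → Matrix (Fin 2) (Fin 2) ℝ}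
    (hg : IsMetric ρ g) {T a₀ B : ℝ} (ha₀ : 0 < a₀) (hB : 0 ≤ B)
    {w wt a : ℝ → ℝ × ℝ → ℝ}
    (hcont : ContinuousOn (fun x : ℝ × (ℝ × ℝ) => w x.1 x.2) (Icc 0 T ×ˢ strip ρ))
    (hper : ∀ t ∈ Icc 0 T, ∀ p ∈ strip ρ, w t (p.1 + 2 * Real.pi, p.2) = w t p)
    (hsm : ∀ t ∈ Ioc 0 T, Sm ρ (w t))
    (hinit : ∀ p ∈ strip ρ, w 0 p ≤ 0)
    (hderiv : ∀ t ∈ Ioc 0 T, ∀ p ∈ strip ρ, HasDerivAt (fun τ => w τ p) (wt t p) t)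
    (ha : ∀ t ∈ Ioc 0 T, ∀ p ∈ fundDomain ρ, a₀ ≤ a t p)
    (hineq : ∀ t ∈ Ioc 0 T, ∀ p ∈ fundDomain ρ, 0 < w t p →
      a t p * wt t p ≤ laplacian ρ g (w t) p + B * w t p)
    (hbd : ∀ t ∈ Ioc 0 T, ∀ p : ℝ × ℝ, (p.2 = -ρ ∨ p.2 = ρ) → 0 < w t p →
      SignType.sign p.2 * gradient ρ g (w t) 1 p ≤ 0) :
    ∀ t ∈ Icc 0 T, ∀ p ∈ strip ρ, w t p ≤ 0 := by
  intro t₂ ht₂ p₂ hp₂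
  by_contra! hw₂
  obtain ⟨p₃, hp₃, hw₃⟩ := exists_mem_fundDomain hp₂ (hper t₂ ht₂)
  rw [← hw₃] at hw₂
  obtain ⟨C, hC⟩ : ∃ C, ∀ p ∈ fundDomain ρ, |laplacian ρ g (fun q => 1 + q.2 ^ 2) p| ≤ C := by
    have hc : ContinuousOn (fun p : ℝ × ℝ => 2 * (g p)⁻¹ 1 1 + 2 * p.2 * laplacianDrift ρ g 1 p)
        (fundDomain ρ) := by
      have h1 := (hg.sm_inv 1 1).continuousOn.mono fundDomain_subset
      have h2 := (hg.sm_laplacianDrift hρ 1).continuousOn.mono fundDomain_subset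
      exact (continuousOn_const.mul h1).add
        ((continuousOn_const.mul continuous_snd.continuousOn).mul h2)
    obtain ⟨C, hC⟩ := isCompact_fundDomain.exists_bound_of_continuousOn hc
    refine ⟨C, fun p hp => ?_⟩
    rw [hg.laplacian_one_add_sq hρ (fundDomain_subset hp)]
    exact hC p hp
  have hC0 : 0 ≤ C := (abs_nonneg _).trans (hC p₃ hp₃)
  -- Chosen so that `a₀ K = C + B + a₀` strictly exceeds the sum of the barrier's Laplacian bound
  -- and the zeroth-order coefficient.
  set K := (C + B) / a₀ + 1 with hK
  have hKpos : 0 < K := by positivity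
  -- With this `ε` the barrier removes exactly half of the positive term at `(t₂, p₃)`, so the
  -- maximum of `Z` is positive.
  set ε := Real.exp (-K * t₂) * w t₂ p₃ / (2 * (1 + p₃.2 ^ 2)) with hε
  have hεpos : 0 < ε := by positivity
  set Z : ℝ × (ℝ × ℝ) → ℝ := fun x => Real.exp (-K * x.1) * w x.1 x.2 - ε * (1 + x.2.2 ^ 2) with hZ
  have hZcont : ContinuousOn Z (Icc 0 T ×ˢ fundDomain ρ) := by
    have := hcont.mono (prod_mono_right fundDomain_subset)
    exact ((Real.continuous_exp.comp (continuous_const.mul continuous_fst)).continuousOn.mul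
      this).sub (Continuous.continuousOn (by fun_prop))
  obtain ⟨⟨t, p⟩, ⟨ht : t ∈ Icc 0 T, hp : p ∈ fundDomain ρ⟩, hmax⟩ :=
    (isCompact_Icc.prod isCompact_fundDomain).exists_isMaxOn ⟨(t₂, p₃), ht₂, hp₃⟩ hZcont
  have hps := fundDomain_subset hp
  have hZpos : 0 < Z (t, p) := by
    refine lt_of_lt_of_le ?_ (hmax (show (t₂, p₃) ∈ _ from ⟨ht₂, hp₃⟩))
    have : ε * (1 + p₃.2 ^ 2) = Real.exp (-K * t₂) * w t₂ p₃ / 2 := by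
      rw [hε]
      field_simp
    simp only [hZ, this]
    have : 0 < Real.exp (-K * t₂) * w t₂ p₃ := by positivity
    linarith
  have hE := Real.exp_pos (-K * t)
  set e := Real.exp (-K * t) with he
  have hew : ε * (1 + p.2 ^ 2) < e * w t p := by
    simp only [hZ] at hZpos
    linarith
  have hw : 0 < w t p := by
    have : 0 < e * w t p := lt_trans (by positivity) hew
    exact pos_of_mul_pos_right this hE.le
  have ht' : t ∈ Ioc 0 T := by
    refine ⟨lt_of_le_of_ne ht.1 ?_, ht.2⟩
    rintro rfl
    exact absurd (hinit p hps) (not_le.2 hw)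
  have htime : K * w t p ≤ wt t p := by
    have h1 : HasDerivAt (fun τ => Z (τ, p)) (e * (wt t p - K * w t p)) t := by
      have h2 : HasDerivAt (fun τ => Real.exp (-K * τ)) (e * (-K)) t := by
        simpa [he] using ((hasDerivAt_id t).const_mul (-K)).exp
      refine ((h2.fun_mul (hderiv t ht' p hps)).sub_const (ε * (1 + p.2 ^ 2))).congr_deriv ?_
      ring
    -- Only earlier times are compared, since `t` may equal `T`. This already yields a nonnegative
    -- time derivative of `Z`.
    have hm : IsMaxOn (fun τ => Z (τ, p)) (Icc 0 t) t := fun τ hτ =>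
      hmax (show (τ, p) ∈ _ from ⟨⟨hτ.1, hτ.2.trans ht.2⟩, hp⟩)
    have h3 := hm.localize.hasFDerivWithinAt_nonpos h1.hasFDerivAt.hasFDerivWithinAt
      (sub_mem_posTangentConeAt_of_segment_subset
        ((convex_Icc 0 t).segment_subset ⟨ht.1, le_rfl⟩ ⟨le_rfl, ht.1⟩))
    simp only [zero_sub, map_neg, ContinuousLinearMap.toSpanSingleton_apply, smul_eq_mul] at h3
    have h4 : 0 ≤ t * e * (wt t p - K * w t p) := by linarith
    have := nonneg_of_mul_nonneg_right h4 (mul_pos ht'.1 hE)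
    linarith
  have hs1 : Sm ρ (fun q => e * w t q) := contDiffOn_const.mul (hsm t ht')
  have hs2 : Sm ρ (fun q => ε * (1 + q.2 ^ 2)) := contDiffOn_const.mul sm_one_add_sq
  have hs : Sm ρ (fun q => e * w t q - ε * (1 + q.2 ^ 2)) := hs1.sub hs2
  have hspace : ∀ q ∈ strip ρ, e * w t q - ε * (1 + q.2 ^ 2) ≤ e * w t p - ε * (1 + p.2 ^ 2) := by
    intro q hq
    obtain ⟨q', hq', hqq⟩ := exists_mem_fundDomain hq (f := fun q => e * w t q - ε * (1 + q.2 ^ 2))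
      (fun q hq => by simp only [hper t ht q hq])
    rw [← hqq]
    exact hmax (show (t, q') ∈ _ from ⟨ht, hq'⟩)
  -- On the boundary, `w` has nonpositive outward flux and the barrier strictly positive flux, so
  -- `Z` strictly decreases outward, which is impossible at a maximum.
  by_cases hb : p.2 = -ρ ∨ p.2 = ρ
  · have h0 := pd_zero_eq_zero_of_max hρ hs hps hspace
    have h1 := fun s hs' => sub_mul_pd_one_nonpos_of_max hρ hs hps hspace (s := s) hs'
    have hgr : gradient ρ g (fun q => e * w t q - ε * (1 + q.2 ^ 2)) 1 p =
        e * gradient ρ g (w t) 1 p - ε * (2 * p.2 * (g p)⁻¹ 1 1) := by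
      rw [gradient_sub hρ hs1 hs2 hps, gradient_const_mul hρ (hsm t ht') _ hps,
        gradient_const_mul hρ sm_one_add_sq _ hps]
      simp only [gradient, Fin.sum_univ_two, pd_one_add_sq hρ hps, if_true, one_ne_zero, if_false]
      ring
    have hgr2 : gradient ρ g (fun q => e * w t q - ε * (1 + q.2 ^ 2)) 1 p =
        (g p)⁻¹ 1 1 * pd ρ 1 (fun q => e * w t q - ε * (1 + q.2 ^ 2)) p := by
      simp [gradient, Fin.sum_univ_two, h0]
    rw [hgr2] at hgr
    have hi := hg.inv_one_pos hps
    have hbd' := hbd t ht' p hb hw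
    set G := gradient ρ g (w t) 1 p
    set D := pd ρ 1 (fun q => e * w t q - ε * (1 + q.2 ^ 2)) p
    have hpos : 0 < ε * ρ * (g p)⁻¹ 1 1 := by positivity
    rcases hb with hb | hb
    · have h2 := h1 ρ ⟨by linarith, le_rfl⟩
      have hsg : SignType.sign p.2 = -1 := by rw [hb]; exact sign_neg (by linarith)
      rw [hsg] at hbd'
      simp at hbd'
      rw [hb] at h2 hgr
      have h3 : D ≤ 0 := by by_contra! h; nlinarith
      have h4 := mul_nonneg hE.le hbd'
      have h5 := mul_nonneg_of_nonpos_of_nonpos h3 (neg_nonpos.2 hi.le)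
      nlinarith
    · have h2 := h1 (-ρ) ⟨le_rfl, by linarith⟩
      have hsg : SignType.sign p.2 = 1 := by rw [hb]; exact sign_pos hρ
      rw [hsg] at hbd'
      simp at hbd'
      rw [hb] at h2 hgr
      have h3 : 0 ≤ D := by by_contra! h; nlinarith
      have h4 := mul_nonneg hE.le (neg_nonneg.2 hbd')
      have h5 := mul_nonneg h3 hi.le
      nlinarith
  · have hint : p.2 ∈ Ioo (-ρ) ρ := by
      have h := mem_strip.1 hps
      push Not at hb
      exact ⟨lt_of_le_of_ne h.1 (Ne.symm hb.1), lt_of_le_of_ne h.2 hb.2⟩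
    have hl := hg.laplacian_nonpos_of_max hρ hs hint hspace
    rw [hg.laplacian_sub hρ hs1 hs2 hps, hg.laplacian_const_mul hρ (hsm t ht') _ hps,
      hg.laplacian_const_mul hρ sm_one_add_sq _ hps] at hl
    have h1 := (abs_le.1 (hC p hp)).2
    have h2 := hineq t ht' p hp hw
    have h3 := ha t ht' p hp
    set L := laplacian ρ g (w t) p
    -- At an interior maximum `e L` is at most `ε` times the Laplacian of the barrier, and `ε ≤ ε (1
    -- + s²) < e w` because `Z > 0` there.
    have h4 : e * L ≤ e * (C * w t p) := by
      have h5 : ε * laplacian ρ g (fun q => 1 + q.2 ^ 2) p ≤ ε * C :=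
        mul_le_mul_of_nonneg_left h1 hεpos.le
      have h6 : ε * 1 ≤ e * w t p := le_trans
        (mul_le_mul_of_nonneg_left (by nlinarith [sq_nonneg p.2]) hεpos.le) hew.le
      have h7 := mul_le_mul_of_nonneg_right h6 hC0
      linarith
    have h5 : L ≤ C * w t p := le_of_mul_le_mul_left h4 hE
    have h6 : a₀ * (K * w t p) ≤ a t p * wt t p :=
      mul_le_mul h3 htime (by positivity) (ha₀.le.trans h3)
    have h7 : a₀ * K = C + B + a₀ := by
      rw [hK]
      field_simp
    have h8 : (C + B + a₀) * w t p ≤ (C + B) * w t p := by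
      rw [← h7]
      linarith
    have := mul_pos ha₀ hw
    linarith

/-! ### The scalar equation for the conformal factor and its monotonicity. -/

/-- The positive function `φ` with `g = φ g₀`, for a metric `g` conformal to `g₀`. -/
noncomputable def conformalFactor (g₀ g : ℝ × ℝ → Matrix (Fin 2) (Fin 2) ℝ) (p : ℝ × ℝ) : ℝ :=
  g p 0 0 / g₀ p 0 0

namespace IsRicciFlow

variable {ρ : ℝ} {T : EReal} {g₀ : ℝ × ℝ → Matrix (Fin 2) (Fin 2) ℝ}
  {g : ℝ → ℝ × ℝ → Matrix (Fin 2) (Fin 2) ℝ} {t : ℝ} {p : ℝ × ℝ}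

/-- All components of the metric obey the same linear equation in time, so the ratios `gᵢⱼ / g₀₀`
have zero derivative. Continuity at time `0` identifies them with those of `g₀`. -/
theorem conformal (H : IsRicciFlow ρ T g₀ g) (ht : 0 ≤ t) (htT : (t : EReal) < T)
    (hp : p ∈ strip ρ) : g t p = conformalFactor g₀ (g t) p • g₀ p := by
  have hlt : ∀ τ ∈ Icc 0 t, (τ : EReal) < T := fun τ hτ =>
    lt_of_le_of_lt (EReal.coe_le_coe_iff.2 hτ.2) htT
  have hpos : ∀ τ ∈ Icc 0 t, g τ p 0 0 ≠ 0 := fun τ hτ =>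
    ((H.metric τ hτ.1 (hlt τ hτ)).pos_zero hp).ne'
  have hc : ∀ i j, ContinuousOn (fun τ => g τ p i j) (Icc 0 t) := fun i j =>
    (H.continuousOn_zero i j).comp (f := fun τ : ℝ => (τ, p)) (by fun_prop)
      fun τ hτ => ⟨⟨hτ.1, hlt τ hτ⟩, hp⟩
  have key : ∀ i j, g t p i j / g t p 0 0 = g 0 p i j / g 0 p 0 0 := by
    intro i j
    rcases ht.eq_or_lt with rfl | ht0
    · rfl
    have hd : ∀ τ ∈ Ioo 0 t, HasDerivAt (fun τ => g τ p i j / g τ p 0 0) 0 τ := fun τ hτ => by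
      have hT := hlt τ (Ioo_subset_Icc_self hτ)
      refine ((H.evolution τ hτ.1 hT p hp i j).fun_div (H.evolution τ hτ.1 hT p hp 0 0)
        (hpos τ (Ioo_subset_Icc_self hτ))).congr_deriv ?_
      ring
    obtain ⟨c, -, hc'⟩ := exists_hasDerivAt_eq_slope _ _ ht0 ((hc i j).div (hc 0 0) hpos) hd
    rw [eq_div_iff (by linarith), zero_mul] at hc'
    exact (sub_eq_zero.1 hc'.symm)
  ext i j
  have h := key i j
  have h0 := hpos t ⟨ht, le_rfl⟩
  rw [H.initial p hp] at h
  rw [Matrix.smul_apply, smul_eq_mul, conformalFactor, div_mul_eq_mul_div, mul_div_assoc, ← h]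
  field_simp

theorem conformalFactor_pos (H : IsRicciFlow ρ T g₀ g) (hg₀ : IsMetric ρ g₀) (ht : 0 ≤ t)
    (htT : (t : EReal) < T) (hp : p ∈ strip ρ) : 0 < conformalFactor g₀ (g t) p :=
  div_pos ((H.metric t ht htT).pos_zero hp) (hg₀.pos_zero hp)

theorem sm_conformalFactor (H : IsRicciFlow ρ T g₀ g) (hg₀ : IsMetric ρ g₀) (ht : 0 ≤ t)
    (htT : (t : EReal) < T) : Sm ρ (conformalFactor g₀ (g t)) :=
  ((H.metric t ht htT).smooth 0 0).fun_div (hg₀.smooth 0 0) fun _ hp => (hg₀.pos_zero hp).ne'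

theorem sm_log_conformalFactor (H : IsRicciFlow ρ T g₀ g) (hg₀ : IsMetric ρ g₀) (ht : 0 ≤ t)
    (htT : (t : EReal) < T) : Sm ρ (fun p => Real.log (conformalFactor g₀ (g t) p)) :=
  (H.sm_conformalFactor hg₀ ht htT).log fun _ hp => (H.conformalFactor_pos hg₀ ht htT hp).ne'

theorem conformalFactor_periodic (H : IsRicciFlow ρ T g₀ g) (hg₀ : IsMetric ρ g₀) (ht : 0 ≤ t)
    (htT : (t : EReal) < T) (hp : p ∈ strip ρ) :
    conformalFactor g₀ (g t) (p.1 + 2 * Real.pi, p.2) = conformalFactor g₀ (g t) p := by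
  simp only [conformalFactor, (H.metric t ht htT).periodic p hp, hg₀.periodic p hp]

theorem conformalFactor_zero (H : IsRicciFlow ρ T g₀ g) (hg₀ : IsMetric ρ g₀)
    (hp : p ∈ strip ρ) : conformalFactor g₀ (g 0) p = 1 := by
  rw [conformalFactor, H.initial p hp, div_self (hg₀.pos_zero hp).ne']

theorem continuousOn_conformalFactor (H : IsRicciFlow ρ T g₀ g) (hg₀ : IsMetric ρ g₀) :
    ContinuousOn (fun x : ℝ × (ℝ × ℝ) => conformalFactor g₀ (g x.1) x.2)
      ({t : ℝ | 0 ≤ t ∧ (t : EReal) < T} ×ˢ strip ρ) :=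
  (H.continuousOn_zero 0 0).div
    ((hg₀.smooth 0 0).continuousOn.comp continuousOn_snd fun _ hx => hx.2)
    fun _ hx => (hg₀.pos_zero hx.2).ne'

theorem hasDerivAt_conformalFactor (H : IsRicciFlow ρ T g₀ g) (ht : 0 < t)
    (htT : (t : EReal) < T) (hp : p ∈ strip ρ) :
    HasDerivAt (fun τ => conformalFactor g₀ (g τ) p)
      (-scalarCurv ρ (g t) p * conformalFactor g₀ (g t) p) t := by
  refine ((H.evolution t ht htT p hp 0 0).div_const (g₀ p 0 0)).congr_deriv ?_
  rw [conformalFactor, mul_div_assoc]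

theorem scalarCurv_eq (H : IsRicciFlow ρ T g₀ g) (hρ : 0 < ρ) (hg₀ : IsMetric ρ g₀) (ht : 0 ≤ t)
    (htT : (t : EReal) < T) (hp : p ∈ strip ρ) :
    conformalFactor g₀ (g t) p * scalarCurv ρ (g t) p = scalarCurv ρ g₀ p -
      laplacian ρ g₀ (fun q => Real.log (conformalFactor g₀ (g t) q)) p :=
  scalarCurv_conformal hρ hg₀ (H.sm_conformalFactor hg₀ ht htT)
    (fun _ hq => H.conformalFactor_pos hg₀ ht htT hq) (fun _ hq => H.conformal ht htT hq) hp

theorem mem_strip_of_boundary (hρ : 0 < ρ) (hp : p.2 = -ρ ∨ p.2 = ρ) : p ∈ strip ρ := by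
  rw [mem_strip]
  rcases hp with h | h <;> rw [h] <;> constructor <;> linarith

theorem gradient_boundary (H : IsRicciFlow ρ T g₀ g) (hρ : 0 < ρ) (hg₀ : IsMetric ρ g₀)
    (ht : 0 < t) (htT : (t : EReal) < T) (hp : p.2 = -ρ ∨ p.2 = ρ) :
    SignType.sign p.2 * gradient ρ g₀ (fun q => Real.log (conformalFactor g₀ (g t) q)) 1 p =
      2 * √((g₀ p)⁻¹ 1 1) * geodesicCurv ρ g₀ p * (√(conformalFactor g₀ (g t) p) - 1) := by
  have hps := mem_strip_of_boundary hρ hp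
  have h := geodesicCurv_conformal hρ hg₀ (H.sm_conformalFactor hg₀ ht.le htT)
    (fun _ hq => H.conformalFactor_pos hg₀ ht.le htT hq) (fun _ hq => H.conformal ht.le htT hq) hps
  rw [H.boundary t ht htT p hp] at h
  have hi : √((g₀ p)⁻¹ 1 1) ≠ 0 := (Real.sqrt_pos.2 (hg₀.inv_one_pos hps)).ne'
  field_simp at h
  linear_combination -h

/-- The expression is the time derivative of a jointly smooth function, so its joint continuity
needs no analysis of the curvature formula. -/
theorem continuousOn_deriv_conformalFactor (H : IsRicciFlow ρ T g₀ g) (hρ : 0 < ρ)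
    (hg₀ : IsMetric ρ g₀) :
    ContinuousOn (fun x : ℝ × (ℝ × ℝ) => -scalarCurv ρ (g x.1) x.2 * conformalFactor g₀ (g x.1) x.2)
      ({t : ℝ | 0 < t ∧ (t : EReal) < T} ×ˢ strip ρ) := by
  set I := {t : ℝ | 0 < t ∧ (t : EReal) < T} with hI
  have hopen : IsOpen I := isOpen_Ioi.inter (isOpen_Iio.preimage continuous_coe_real_ereal)
  have hU : UniqueDiffOn ℝ (I ×ˢ strip ρ) := hopen.uniqueDiffOn.prod (uniqueDiffOn_strip hρ)
  have hs := H.smooth 0 0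
  have hc := ((hs.continuousOn_fderivWithin hU (by simp)).clm_apply
    (continuousOn_const (c := ((1 : ℝ), ((0 : ℝ), (0 : ℝ)))))).div
    ((hg₀.smooth 0 0).continuousOn.comp continuousOn_snd fun (x : ℝ × (ℝ × ℝ)) hx => hx.2)
    fun _ hx => (hg₀.pos_zero hx.2).ne'
  refine hc.congr ?_
  rintro ⟨t, p⟩ ⟨ht, hp⟩
  have h1 := (hs.differentiableOn (by simp) (t, p) ⟨ht, hp⟩).hasFDerivWithinAt
  have h2 : HasDerivWithinAt (fun τ : ℝ => (τ, p)) ((1 : ℝ), ((0 : ℝ), (0 : ℝ))) I t :=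
    ((hasDerivAt_id t).prodMk (hasDerivAt_const t p)).hasDerivWithinAt
  have h3 := (HasFDerivWithinAt.comp_hasDerivWithinAt (t := I ×ˢ strip ρ) t h1 h2
    fun τ hτ => ⟨hτ, hp⟩).hasDerivAt (hopen.mem_nhds ht)
  have h4 := h3.unique (H.evolution t ht.1 ht.2 p hp 0 0)
  simp only [Pi.div_apply, Function.comp_apply]
  rw [h4, conformalFactor, mul_div_assoc]

theorem exists_bound_deriv (H : IsRicciFlow ρ T g₀ g) (hρ : 0 < ρ) (hg₀ : IsMetric ρ g₀)
    {a b : ℝ} (ha : 0 < a) (hb : (b : EReal) < T) :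
    ∃ B, 0 ≤ B ∧ ∀ t ∈ Icc a b, ∀ p ∈ fundDomain ρ,
      |(-scalarCurv ρ (g t) p * conformalFactor g₀ (g t) p)| ≤ B := by
  have hsub : Icc a b ×ˢ fundDomain ρ ⊆ {t : ℝ | 0 < t ∧ (t : EReal) < T} ×ˢ strip ρ := fun x hx =>
    ⟨⟨ha.trans_le hx.1.1, lt_of_le_of_lt (EReal.coe_le_coe_iff.2 hx.1.2) hb⟩,
      fundDomain_subset hx.2⟩
  have hc := (H.continuousOn_deriv_conformalFactor hρ hg₀).mono hsub
  obtain ⟨B, hB⟩ := (isCompact_Icc.prod isCompact_fundDomain).exists_bound_of_continuousOn hc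
  exact ⟨max B 0, le_max_right _ _, fun t ht p hp => (hB (t, p) ⟨ht, hp⟩).trans (le_max_left _ _)⟩

theorem exists_pos_le_conformalFactor (H : IsRicciFlow ρ T g₀ g) (hρ : 0 < ρ) (hg₀ : IsMetric ρ g₀)
    (ht : 0 ≤ t) (htT : (t : EReal) < T) :
    ∃ a, 0 < a ∧ ∀ τ ∈ Icc 0 t, ∀ p ∈ fundDomain ρ, a ≤ conformalFactor g₀ (g τ) p := by
  have hlt : ∀ τ ∈ Icc 0 t, (τ : EReal) < T := fun τ hτ =>
    lt_of_le_of_lt (EReal.coe_le_coe_iff.2 hτ.2) htT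
  have hsub : Icc 0 t ×ˢ fundDomain ρ ⊆ {t : ℝ | 0 ≤ t ∧ (t : EReal) < T} ×ˢ strip ρ := fun x hx =>
    ⟨⟨hx.1.1, hlt _ hx.1⟩, fundDomain_subset hx.2⟩
  have hc := (H.continuousOn_conformalFactor hg₀).mono hsub
  obtain ⟨⟨τ, p⟩, ⟨hτ, hp⟩, hmin⟩ :=
    (isCompact_Icc.prod isCompact_fundDomain).exists_isMinOn
      ⟨(0, (0, 0)), ⟨le_rfl, ht⟩, ⟨le_rfl, Real.two_pi_pos.le⟩, by simp [hρ.le]⟩ hc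
  exact ⟨_, H.conformalFactor_pos hg₀ hτ.1 (hlt τ hτ) (fundDomain_subset hp),
    fun τ' hτ' p' hp' => hmin (show (τ', p') ∈ _ from ⟨hτ', hp'⟩)⟩

theorem continuousOn_log_conformalFactor (H : IsRicciFlow ρ T g₀ g) (hg₀ : IsMetric ρ g₀) {s h : ℝ}
    (hh : 0 ≤ h) (hsT : ((s + h : ℝ) : EReal) < T) :
    ContinuousOn (fun x : ℝ × (ℝ × ℝ) => Real.log (conformalFactor g₀ (g (x.1 + h)) x.2))
      (Icc 0 s ×ˢ strip ρ) := by
  have hm : MapsTo (fun x : ℝ × (ℝ × ℝ) => (x.1 + h, x.2)) (Icc 0 s ×ˢ strip ρ)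
      ({t : ℝ | 0 ≤ t ∧ (t : EReal) < T} ×ˢ strip ρ) := fun x hx =>
    ⟨⟨add_nonneg hx.1.1 hh, lt_of_le_of_lt (EReal.coe_le_coe_iff.2 (by linarith [hx.1.2])) hsT⟩,
      hx.2⟩
  exact ((H.continuousOn_conformalFactor hg₀).comp (by fun_prop) hm).log
    fun x hx => (H.conformalFactor_pos hg₀ (hm hx).1.1 (hm hx).1.2 hx.2).ne'

/-- For `v = log φ` one has `φ ∂ₜv = Δ₀v - R₀ ≤ Δ₀v`. Where `v > 0` also `√φ ≥ 1`, so the boundary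
flux `2 k₀ (√φ - 1)` is nonpositive and the maximum principle applies to `v`. -/
theorem conformalFactor_le_one (H : IsRicciFlow ρ T g₀ g) (hρ : 0 < ρ) (hg₀ : IsMetric ρ g₀)
    (hR : ∀ p ∈ strip ρ, 0 ≤ scalarCurv ρ g₀ p)
    (hk : ∀ p : ℝ × ℝ, (p.2 = -ρ ∨ p.2 = ρ) → geodesicCurv ρ g₀ p ≤ 0)
    (ht : 0 ≤ t) (htT : (t : EReal) < T) (hp : p ∈ strip ρ) :
    conformalFactor g₀ (g t) p ≤ 1 := by
  have hlt : ∀ τ ≤ t, (τ : EReal) < T := fun τ hτ =>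
    lt_of_le_of_lt (EReal.coe_le_coe_iff.2 hτ) htT
  obtain ⟨a, ha, hle⟩ := H.exists_pos_le_conformalFactor hρ hg₀ ht htT
  have key := maximum_principle hρ hg₀ (T := t) (B := 0)
    (w := fun τ p => Real.log (conformalFactor g₀ (g τ) p))
    (wt := fun τ p => (-scalarCurv ρ (g τ) p * conformalFactor g₀ (g τ) p) /
      conformalFactor g₀ (g τ) p)
    (a := fun τ p => conformalFactor g₀ (g τ) p) ha le_rfl
    (by simpa using H.continuousOn_log_conformalFactor hg₀ le_rfl (s := t) (by simpa using htT))
    (fun τ hτ p hp => by simp only [H.conformalFactor_periodic hg₀ hτ.1 (hlt τ hτ.2) hp])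
    (fun τ hτ => H.sm_log_conformalFactor hg₀ hτ.1.le (hlt τ hτ.2))
    (fun p hp => by simp [H.conformalFactor_zero hg₀ hp])
    (fun τ hτ p hp => (H.hasDerivAt_conformalFactor hτ.1 (hlt τ hτ.2) hp).log
      (H.conformalFactor_pos hg₀ hτ.1.le (hlt τ hτ.2) hp).ne')
    (fun τ hτ p hp => hle τ (Ioc_subset_Icc_self hτ) p hp)
    (fun τ hτ p hp _ => by
      have hp := fundDomain_subset hp
      have h1 := H.scalarCurv_eq hρ hg₀ hτ.1.le (hlt τ hτ.2) hp
      rw [mul_div_cancel₀ _ (H.conformalFactor_pos hg₀ hτ.1.le (hlt τ hτ.2) hp).ne']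
      linarith [hR p hp])
    (fun τ hτ p hp hw => by
      have hps := mem_strip_of_boundary hρ hp
      have h0 := H.conformalFactor_pos hg₀ hτ.1.le (hlt τ hτ.2) hps
      rw [H.gradient_boundary hρ hg₀ hτ.1 (hlt τ hτ.2) hp]
      have h1 : 1 ≤ √(conformalFactor g₀ (g τ) p) :=
        Real.one_le_sqrt.2 ((Real.log_pos_iff h0.le).1 hw).le
      exact mul_nonpos_of_nonpos_of_nonneg
        (mul_nonpos_of_nonneg_of_nonpos (by positivity) (hk p hp)) (by linarith))
  exact (Real.log_nonpos_iff (H.conformalFactor_pos hg₀ ht htT hp).le).1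
    (key t ⟨ht, le_rfl⟩ p hp)

/-- The maximum principle is applied to `w = log φ(τ + h) - log φ(τ)`. Initially `w ≤ 0` by
`conformalFactor_le_one`. In the difference of the two equations `R₀` cancels, and where `w > 0` the
difference of the boundary fluxes has the sign of `k₀`. -/
theorem conformalFactor_antitone (H : IsRicciFlow ρ T g₀ g) (hρ : 0 < ρ) (hg₀ : IsMetric ρ g₀)
    (hR : ∀ p ∈ strip ρ, 0 ≤ scalarCurv ρ g₀ p)
    (hk : ∀ p : ℝ × ℝ, (p.2 = -ρ ∨ p.2 = ρ) → geodesicCurv ρ g₀ p ≤ 0)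
    {s : ℝ} (hs : 0 ≤ s) (hst : s < t) (htT : (t : EReal) < T) (hp : p ∈ strip ρ) :
    conformalFactor g₀ (g t) p ≤ conformalFactor g₀ (g s) p := by
  obtain ⟨h, hh, rfl⟩ : ∃ h, 0 < h ∧ t = s + h := ⟨t - s, by linarith, by ring⟩
  have hlt : ∀ τ ≤ s + h, (τ : EReal) < T := fun τ hτ =>
    lt_of_le_of_lt (EReal.coe_le_coe_iff.2 hτ) htT
  have hsT := hlt s (by linarith)
  obtain ⟨a, ha, hle⟩ := H.exists_pos_le_conformalFactor hρ hg₀ hs hsT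
  obtain ⟨B, hB, hbound⟩ := H.exists_bound_deriv hρ hg₀ hh htT
  have hpos : ∀ τ, 0 ≤ τ → τ ≤ s + h → ∀ p ∈ strip ρ, 0 < conformalFactor g₀ (g τ) p :=
    fun τ h0 h1 p hp => H.conformalFactor_pos hg₀ h0 (hlt τ h1) hp
  have key := maximum_principle hρ hg₀ (T := s) (B := B)
    (w := fun τ p => Real.log (conformalFactor g₀ (g (τ + h)) p) -
      Real.log (conformalFactor g₀ (g τ) p))
    (wt := fun τ p => (-scalarCurv ρ (g (τ + h)) p * conformalFactor g₀ (g (τ + h)) p) /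
      conformalFactor g₀ (g (τ + h)) p - (-scalarCurv ρ (g τ) p * conformalFactor g₀ (g τ) p) /
      conformalFactor g₀ (g τ) p)
    (a := fun τ p => conformalFactor g₀ (g τ) p) ha hB
    ((H.continuousOn_log_conformalFactor hg₀ hh.le htT).sub
      (by simpa using H.continuousOn_log_conformalFactor hg₀ le_rfl (s := s) (by simpa using hsT)))
    (fun τ hτ p hp => by
      simp only [H.conformalFactor_periodic hg₀ hτ.1 (hlt τ (by linarith [hτ.2])) hp,
        H.conformalFactor_periodic hg₀ (add_nonneg hτ.1 hh.le) (hlt _ (by linarith [hτ.2])) hp])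
    (fun τ hτ => (H.sm_log_conformalFactor hg₀ (add_nonneg hτ.1.le hh.le)
        (hlt _ (by linarith [hτ.2]))).sub
      (H.sm_log_conformalFactor hg₀ hτ.1.le (hlt _ (by linarith [hτ.2]))))
    (fun p hp => by
      have h1 := hpos h hh.le (by linarith) p hp
      have h2 := H.conformalFactor_le_one hρ hg₀ hR hk hh.le (hlt h (by linarith)) hp
      simpa [H.conformalFactor_zero hg₀ hp] using Real.log_nonpos h1.le h2)
    (fun τ hτ p hp => by
      have h1 := (H.hasDerivAt_conformalFactor (t := τ + h) (add_pos hτ.1 hh)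
        (hlt _ (by linarith [hτ.2])) hp).comp_add_const τ h
      exact (h1.log (hpos _ (add_nonneg hτ.1.le hh.le) (by linarith [hτ.2]) p hp).ne').sub
        ((H.hasDerivAt_conformalFactor hτ.1 (hlt _ (by linarith [hτ.2])) hp).log
          (hpos _ hτ.1.le (by linarith [hτ.2]) p hp).ne'))
    (fun τ hτ p hp => hle τ (Ioc_subset_Icc_self hτ) p hp)
    (fun τ hτ p hp hw => by
      have hps := fundDomain_subset hp
      have hτ1 : 0 ≤ τ + h := add_nonneg hτ.1.le hh.le
      have hτ2 : τ + h ≤ s + h := by linarith [hτ.2]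
      have hτ3 : τ ≤ s + h := by linarith [hτ.2]
      have e1 := H.scalarCurv_eq hρ hg₀ hτ1 (hlt _ hτ2) hps
      have e2 := H.scalarCurv_eq hρ hg₀ hτ.1.le (hlt _ hτ3) hps
      have p1 := hpos _ hτ1 hτ2 p hps
      have p2 := hpos _ hτ.1.le hτ3 p hps
      have hb := (abs_le.1 (hbound (τ + h) ⟨by linarith [hτ.1], hτ2⟩ p hp)).1
      rw [hg₀.laplacian_sub hρ (H.sm_log_conformalFactor hg₀ hτ1 (hlt _ hτ2))
        (H.sm_log_conformalFactor hg₀ hτ.1.le (hlt _ hτ3)) hps]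
      -- Subtracting the equations gives `φ₂ ∂ₜw = Δ₀w + φ₁R₁ (1 - φ₂/φ₁)`. The error is at most `B
      -- w` because `1 - 1/x ≤ log x`. The bound `B` is taken at the shifted times, which stay at
      -- least `h` away from `0`.
      have hlog := Real.one_sub_inv_le_log_of_pos (div_pos p1 p2)
      rw [Real.log_div p1.ne' p2.ne', inv_div] at hlog
      have hfrac : 0 ≤ 1 - conformalFactor g₀ (g τ) p / conformalFactor g₀ (g (τ + h)) p := by
        rw [sub_nonneg, div_le_one p1]
        exact ((Real.log_lt_log_iff p2 p1).1 (by linarith)).le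
      set φ₁ := conformalFactor g₀ (g (τ + h)) p
      set φ₂ := conformalFactor g₀ (g τ) p
      have h3 : -(-scalarCurv ρ (g (τ + h)) p * φ₁) * (1 - φ₂ / φ₁) ≤ B * (1 - φ₂ / φ₁) :=
        mul_le_mul_of_nonneg_right (by linarith) hfrac
      have h4 := mul_le_mul_of_nonneg_left hlog hB
      have h5 : φ₂ * (-scalarCurv ρ (g (τ + h)) p * φ₁ / φ₁ - -scalarCurv ρ (g τ) p * φ₂ / φ₂) =
          -(φ₁ * scalarCurv ρ (g (τ + h)) p) + φ₂ * scalarCurv ρ (g τ) p +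
            -(-scalarCurv ρ (g (τ + h)) p * φ₁) * (1 - φ₂ / φ₁) := by
        field_simp
        ring
      rw [h5, e1, e2]
      linarith)
    (fun τ hτ p hp hw => by
      have hps := mem_strip_of_boundary hρ hp
      have hτ1 : 0 < τ + h := add_pos hτ.1 hh
      have hτ2 : τ + h ≤ s + h := by linarith [hτ.2]
      have hτ3 : τ ≤ s + h := by linarith [hτ.2]
      have p1 := hpos _ hτ1.le hτ2 p hps
      have p2 := hpos _ hτ.1.le hτ3 p hps
      rw [gradient_sub hρ (H.sm_log_conformalFactor hg₀ hτ1.le (hlt _ hτ2))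
        (H.sm_log_conformalFactor hg₀ hτ.1.le (hlt _ hτ3)) hps, mul_sub,
        H.gradient_boundary hρ hg₀ hτ1 (hlt _ hτ2) hp,
        H.gradient_boundary hρ hg₀ hτ.1 (hlt _ hτ3) hp, ← mul_sub]
      have h1 := Real.sqrt_le_sqrt ((Real.log_lt_log_iff p2 p1).1 (by linarith)).le
      exact mul_nonpos_of_nonpos_of_nonneg
        (mul_nonpos_of_nonneg_of_nonpos (by positivity) (hk p hp)) (by linarith))
  have := key s ⟨hs, le_rfl⟩ p hp
  exact (Real.log_le_log_iff (hpos _ (by linarith) le_rfl p hp)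
    (hpos s hs (by linarith) p hp)).1 (by linarith)

end IsRicciFlow

/-! ### Divergence theorem, total curvature and area. -/

open MeasureTheory

variable {ρ : ℝ}

theorem intervalIntegral_eq_setIntegral_fundDomain (hρ : 0 < ρ) {f : ℝ × ℝ → ℝ}
    (hf : ContinuousOn f (fundDomain ρ)) :
    ∫ θ in (0 : ℝ)..(2 * Real.pi), ∫ s in (-ρ)..ρ, f (θ, s) = ∫ p in fundDomain ρ, f p := by
  have hi : IntegrableOn f (fundDomain ρ) (volume.prod volume) :=
    hf.integrableOn_compact isCompact_fundDomain
  rw [Measure.volume_eq_prod, fundDomain, setIntegral_prod f hi,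
    intervalIntegral.integral_of_le Real.two_pi_pos.le, integral_Icc_eq_integral_Ioc]
  simp only [intervalIntegral.integral_of_le (show -ρ ≤ ρ by linarith),
    integral_Icc_eq_integral_Ioc]

/-- The contributions of the sides `θ = 0` and `θ = 2π` cancel by periodicity of `X`. -/
theorem setIntegral_divergence (hρ : 0 < ρ) {X Y : ℝ × ℝ → ℝ} (hX : Sm ρ X) (hY : Sm ρ Y)
    (hper : ∀ p ∈ strip ρ, X (p.1 + 2 * Real.pi, p.2) = X p) :
    ∫ p in fundDomain ρ, (pd ρ 0 X p + pd ρ 1 Y p) =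
      (∫ θ in (0 : ℝ)..(2 * Real.pi), Y (θ, ρ)) - ∫ θ in (0 : ℝ)..(2 * Real.pi), Y (θ, -ρ) := by
  have hle : -ρ ≤ ρ := by linarith
  have hc : ContinuousOn (fun p => pd ρ 0 X p + pd ρ 1 Y p) (fundDomain ρ) :=
    (((hX.pd hρ 0).add (hY.pd hρ 1)).continuousOn).mono fundDomain_subset
  have heq : ∀ p ∈ fundDomain ρ, fderivWithin ℝ X (strip ρ) p (1, 0) +
      fderivWithin ℝ Y (strip ρ) p (0, 1) = pd ρ 0 X p + pd ρ 1 Y p := fun p hp => by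
    rw [hX.pd_eq hρ (fundDomain_subset hp), hY.pd_eq hρ (fundDomain_subset hp)]
    simp [coordVec]
  have h := integral2_divergence_prod_of_hasFDerivAt_off_countable X Y
    (fderivWithin ℝ X (strip ρ)) (fderivWithin ℝ Y (strip ρ)) 0 (-ρ) (2 * Real.pi) ρ ∅
    countable_empty
    (by
      rw [uIcc_of_le Real.two_pi_pos.le, uIcc_of_le hle]
      exact hX.continuousOn.mono fundDomain_subset)
    (by
      rw [uIcc_of_le Real.two_pi_pos.le, uIcc_of_le hle]
      exact hY.continuousOn.mono fundDomain_subset)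
    (fun x hx => hX.hasFDerivAt (by simpa [hle] using hx.1.2))
    (fun x hx => hY.hasFDerivAt (by simpa [hle] using hx.1.2))
    (by
      rw [uIcc_of_le Real.two_pi_pos.le, uIcc_of_le hle]
      exact (hc.integrableOn_compact isCompact_fundDomain).congr_fun (fun p hp => (heq p hp).symm)
        (measurableSet_Icc.prod measurableSet_Icc))
  have hside : ∫ s in (-ρ)..ρ, X (2 * Real.pi, s) = ∫ s in (-ρ)..ρ, X (0, s) := by
    refine intervalIntegral.integral_congr fun s hs => ?_
    rw [uIcc_of_le hle] at hs
    simpa using hper (0, s) (mem_strip.2 hs)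
  rw [hside, add_sub_cancel_right] at h
  rw [← h, ← intervalIntegral_eq_setIntegral_fundDomain hρ hc]
  refine intervalIntegral.integral_congr fun θ hθ => intervalIntegral.integral_congr fun s hs => ?_
  rw [uIcc_of_le hle] at hs
  rw [uIcc_of_le Real.two_pi_pos.le] at hθ
  exact (heq (θ, s) ⟨hθ, hs⟩).symm

namespace IsRicciFlow

variable {T : EReal} {g₀ : ℝ × ℝ → Matrix (Fin 2) (Fin 2) ℝ}
  {g : ℝ → ℝ × ℝ → Matrix (Fin 2) (Fin 2) ℝ} {t : ℝ}

theorem totalScalarCurv_eq (H : IsRicciFlow ρ T g₀ g) (hρ : 0 < ρ) (hg₀ : IsMetric ρ g₀)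
    (ht : 0 ≤ t) (htT : (t : EReal) < T) :
    totalScalarCurv ρ (g t) = ∫ p in fundDomain ρ,
      conformalFactor g₀ (g t) p * scalarCurv ρ (g t) p * √(g₀ p).det := by
  have hsm : Sm ρ fun p => conformalFactor g₀ (g t) p * scalarCurv ρ (g t) p * √(g₀ p).det :=
    ((H.sm_conformalFactor hg₀ ht htT).mul ((H.metric t ht htT).sm_scalarCurv hρ)).mul
      hg₀.sm_sqrt_det
  rw [← intervalIntegral_eq_setIntegral_fundDomain hρ (hsm.continuousOn.mono fundDomain_subset)]
  refine intervalIntegral.integral_congr fun θ hθ => intervalIntegral.integral_congr fun s hs => ?_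
  rw [uIcc_of_le (by linarith)] at hs
  have hp : (θ, s) ∈ strip ρ := mem_strip.2 hs
  have hφ := H.conformalFactor_pos hg₀ ht htT hp
  have hdet : √(g t (θ, s)).det = conformalFactor g₀ (g t) (θ, s) * √(g₀ (θ, s)).det := by
    conv_lhs => rw [H.conformal ht htT hp]
    rw [Matrix.det_smul, Fintype.card_fin, Real.sqrt_mul (by positivity), Real.sqrt_sq hφ.le]
  simp only [hdet]
  ring

/-- This plays the role of Gauss–Bonnet: integrating `φ R = R₀ - Δ₀ log φ` against `dA₀` leaves a
boundary flux as the only time-dependent term. -/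
theorem totalScalarCurv_eq_boundary (H : IsRicciFlow ρ T g₀ g) (hρ : 0 < ρ)
    (hg₀ : IsMetric ρ g₀) (ht : 0 ≤ t) (htT : (t : EReal) < T) :
    totalScalarCurv ρ (g t) = (∫ p in fundDomain ρ, scalarCurv ρ g₀ p * √(g₀ p).det) -
      ((∫ θ in (0 : ℝ)..(2 * Real.pi), √(g₀ (θ, ρ)).det *
          gradient ρ g₀ (fun q => Real.log (conformalFactor g₀ (g t) q)) 1 (θ, ρ)) -
        ∫ θ in (0 : ℝ)..(2 * Real.pi), √(g₀ (θ, -ρ)).det *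
          gradient ρ g₀ (fun q => Real.log (conformalFactor g₀ (g t) q)) 1 (θ, -ρ)) := by
  have hv := H.sm_log_conformalFactor hg₀ ht htT
  have hX := fun k => hg₀.sm_sqrt_det.mul (hg₀.sm_gradient hρ hv k)
  have hint : ∀ {f : ℝ × ℝ → ℝ}, Sm ρ f → IntegrableOn f (fundDomain ρ) := fun hf =>
    (hf.continuousOn.mono fundDomain_subset).integrableOn_compact isCompact_fundDomain
  rw [H.totalScalarCurv_eq hρ hg₀ ht htT, ← setIntegral_divergence hρ (hX 0) (hX 1),
    ← integral_sub (hint ((hg₀.sm_scalarCurv hρ).mul hg₀.sm_sqrt_det))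
      (hint ((Sm.pd hρ (hX 0) 0).add (Sm.pd hρ (hX 1) 1)))]
  · refine setIntegral_congr_fun (measurableSet_Icc.prod measurableSet_Icc) fun p hp => ?_
    have hp := fundDomain_subset hp
    rw [hg₀.divergence_form hρ hv hp, H.scalarCurv_eq hρ hg₀ ht htT hp]
    ring
  · intro p hp
    rw [hg₀.gradient_periodic (fun q hq => by rw [H.conformalFactor_periodic hg₀ ht htT hq]) hp,
      hg₀.periodic p hp]

/-- By the Neumann condition the flux is `k₀ (√φ - 1)` times a nonnegative factor independent of
time. It increases as `φ` decreases, since `k₀ ≤ 0`. The boundary condition holds only at positive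
times, hence `0 < s`. -/
theorem totalScalarCurv_antitone (H : IsRicciFlow ρ T g₀ g) (hρ : 0 < ρ) (hg₀ : IsMetric ρ g₀)
    (hR : ∀ p ∈ strip ρ, 0 ≤ scalarCurv ρ g₀ p)
    (hk : ∀ p : ℝ × ℝ, (p.2 = -ρ ∨ p.2 = ρ) → geodesicCurv ρ g₀ p ≤ 0)
    {s : ℝ} (hs : 0 < s) (hst : s < t) (htT : (t : EReal) < T) :
    totalScalarCurv ρ (g t) ≤ totalScalarCurv ρ (g s) := by
  have hsT : (s : EReal) < T := lt_trans (EReal.coe_lt_coe_iff.2 hst) htT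
  have ht : 0 < t := hs.trans hst
  rw [H.totalScalarCurv_eq_boundary hρ hg₀ ht.le htT,
    H.totalScalarCurv_eq_boundary hρ hg₀ hs.le hsT]
  have hint : ∀ τ : ℝ, 0 ≤ τ → (τ : EReal) < T → ∀ σ ∈ Icc (-ρ) ρ, IntervalIntegrable
      (fun θ => √(g₀ (θ, σ)).det *
        gradient ρ g₀ (fun q => Real.log (conformalFactor g₀ (g τ) q)) 1 (θ, σ)) volume
        0 (2 * Real.pi) := fun τ h0 hT σ hσ => by
    have hX := hg₀.sm_sqrt_det.mul (hg₀.sm_gradient hρ (H.sm_log_conformalFactor hg₀ h0 hT) 1)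
    exact (hX.continuousOn.comp (f := fun θ : ℝ => (θ, σ)) (by fun_prop)
      fun θ _ => mem_strip.2 hσ).intervalIntegrable
  have hflux : ∀ p : ℝ × ℝ, (p.2 = -ρ ∨ p.2 = ρ) →
      SignType.sign p.2 * gradient ρ g₀ (fun q => Real.log (conformalFactor g₀ (g s) q)) 1 p ≤
      SignType.sign p.2 * gradient ρ g₀ (fun q => Real.log (conformalFactor g₀ (g t) q)) 1 p := by
    intro p hp
    rw [H.gradient_boundary hρ hg₀ hs hsT hp, H.gradient_boundary hρ hg₀ ht htT hp]
    refine mul_le_mul_of_nonpos_left (sub_le_sub_right (Real.sqrt_le_sqrt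
      (H.conformalFactor_antitone hρ hg₀ hR hk hs.le hst htT (mem_strip_of_boundary hρ hp))) 1)
      (mul_nonpos_of_nonneg_of_nonpos (by positivity) (hk p hp))
  have h1 := intervalIntegral.integral_mono_on Real.two_pi_pos.le
    (hint s hs.le hsT ρ ⟨by linarith, le_rfl⟩) (hint t ht.le htT ρ ⟨by linarith, le_rfl⟩)
    fun θ _ => by
      have h := hflux (θ, ρ) (Or.inr rfl)
      simp only [sign_pos hρ, SignType.coe_one, one_mul] at h
      exact mul_le_mul_of_nonneg_left h (Real.sqrt_nonneg _)
  have h2 := intervalIntegral.integral_mono_on Real.two_pi_pos.le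
    (hint t ht.le htT (-ρ) ⟨le_rfl, by linarith⟩) (hint s hs.le hsT (-ρ) ⟨le_rfl, by linarith⟩)
    fun θ _ => by
      have h := hflux (θ, -ρ) (Or.inl rfl)
      simp only [sign_neg (neg_lt_zero.2 hρ), SignType.coe_neg, SignType.coe_one, neg_one_mul,
        neg_le_neg_iff] at h
      exact mul_le_mul_of_nonneg_left h (Real.sqrt_nonneg _)
  linarith

/-- The derivative of the area is minus the total scalar curvature. -/
theorem hasDerivAt_area (H : IsRicciFlow ρ T g₀ g) (hρ : 0 < ρ) (hg₀ : IsMetric ρ g₀)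
    (ht : 0 < t) (htT : (t : EReal) < T) :
    HasDerivAt (fun τ => ∫ p in fundDomain ρ, conformalFactor g₀ (g τ) p * √(g₀ p).det)
      (-totalScalarCurv ρ (g t)) t := by
  -- The window `[t/2, b]` is compact inside `(0, T)`, so the time derivative is uniformly bounded
  -- there and can be dominated.
  obtain ⟨b, htb, hbT⟩ := EReal.lt_iff_exists_real_btwn.1 htT
  have htb : t < b := EReal.coe_lt_coe_iff.1 htb
  have hlt : ∀ τ ∈ Icc (t / 2) b, 0 < τ ∧ (τ : EReal) < T := fun τ hτ =>
    ⟨by linarith [hτ.1], lt_of_le_of_lt (EReal.coe_le_coe_iff.2 hτ.2) hbT⟩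
  obtain ⟨B, -, hB⟩ := H.exists_bound_deriv hρ hg₀ (a := t / 2) (by linarith) hbT
  have hmeas : MeasurableSet (fundDomain ρ) := measurableSet_Icc.prod measurableSet_Icc
  have hint : ∀ {f : ℝ × ℝ → ℝ}, Sm ρ f → IntegrableOn f (fundDomain ρ) := fun hf =>
    (hf.continuousOn.mono fundDomain_subset).integrableOn_compact isCompact_fundDomain
  have hnhds : Icc (t / 2) b ∈ nhds t := Icc_mem_nhds (by linarith) htb
  have hF : ∀ τ ∈ Icc (t / 2) b,
      IntegrableOn (fun p => conformalFactor g₀ (g τ) p * √(g₀ p).det) (fundDomain ρ) :=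
    fun τ hτ => hint ((H.sm_conformalFactor hg₀ (hlt τ hτ).1.le (hlt τ hτ).2).mul hg₀.sm_sqrt_det)
  have hF' : IntegrableOn (fun p => -scalarCurv ρ (g t) p * conformalFactor g₀ (g t) p *
      √(g₀ p).det) (fundDomain ρ) :=
    hint (((((H.metric t ht.le htT).sm_scalarCurv hρ).neg).mul
      (H.sm_conformalFactor hg₀ ht.le htT)).mul hg₀.sm_sqrt_det)
  have h := (hasDerivAt_integral_of_dominated_loc_of_deriv_le
    (μ := volume.restrict (fundDomain ρ))
    (F := fun τ p => conformalFactor g₀ (g τ) p * √(g₀ p).det)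
    (F' := fun τ p => -scalarCurv ρ (g τ) p * conformalFactor g₀ (g τ) p * √(g₀ p).det)
    (bound := fun p => B * √(g₀ p).det) hnhds
    (Filter.mem_of_superset hnhds fun τ hτ => (hF τ hτ).aestronglyMeasurable)
    (hF t (mem_of_mem_nhds hnhds)) hF'.aestronglyMeasurable
    ((ae_restrict_iff' hmeas).2 (Filter.Eventually.of_forall fun p hp τ hτ => by
      rw [norm_mul, Real.norm_of_nonneg (Real.sqrt_nonneg _)]
      exact mul_le_mul_of_nonneg_right (hB τ hτ p hp) (Real.sqrt_nonneg _)))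
    ((hint hg₀.sm_sqrt_det).const_mul B)
    ((ae_restrict_iff' hmeas).2 (Filter.Eventually.of_forall fun p hp τ hτ =>
      (H.hasDerivAt_conformalFactor (hlt τ hτ).1 (hlt τ hτ).2
        (fundDomain_subset hp)).mul_const _))).2
  refine h.congr_deriv ?_
  rw [H.totalScalarCurv_eq hρ hg₀ ht.le htT, ← integral_neg]
  congr 1
  funext p
  ring

theorem continuousOn_area (H : IsRicciFlow ρ T g₀ g) (hg₀ : IsMetric ρ g₀)
    (htT : (t : EReal) < T) :
    ContinuousOn (fun τ => ∫ p in fundDomain ρ, conformalFactor g₀ (g τ) p * √(g₀ p).det)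
      (Icc 0 t) := by
  have hlt : ∀ τ ∈ Icc 0 t, 0 ≤ τ ∧ (τ : EReal) < T := fun τ hτ =>
    ⟨hτ.1, lt_of_le_of_lt (EReal.coe_le_coe_iff.2 hτ.2) htT⟩
  have hsub : Icc 0 t ×ˢ fundDomain ρ ⊆ {t : ℝ | 0 ≤ t ∧ (t : EReal) < T} ×ˢ strip ρ := fun x hx =>
    ⟨hlt _ hx.1, fundDomain_subset hx.2⟩
  have hc := (H.continuousOn_conformalFactor hg₀).mono hsub
  obtain ⟨B, hB⟩ := (isCompact_Icc.prod isCompact_fundDomain).exists_bound_of_continuousOn hc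
  have hmeas : MeasurableSet (fundDomain ρ) := measurableSet_Icc.prod measurableSet_Icc
  have hint : ∀ {f : ℝ × ℝ → ℝ}, Sm ρ f → IntegrableOn f (fundDomain ρ) := fun hf =>
    (hf.continuousOn.mono fundDomain_subset).integrableOn_compact isCompact_fundDomain
  refine continuousOn_of_dominated (bound := fun p => B * √(g₀ p).det)
    (fun τ hτ => (hint ((H.sm_conformalFactor hg₀ (hlt τ hτ).1 (hlt τ hτ).2).mul
      hg₀.sm_sqrt_det)).aestronglyMeasurable)
    (fun τ hτ => (ae_restrict_iff' hmeas).2 (Filter.Eventually.of_forall fun p hp => ?_))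
    ((hint hg₀.sm_sqrt_det).const_mul B)
    ((ae_restrict_iff' hmeas).2 (Filter.Eventually.of_forall fun p hp => ?_))
  · rw [norm_mul, Real.norm_of_nonneg (Real.sqrt_nonneg _)]
    exact mul_le_mul_of_nonneg_right (hB (τ, p) ⟨hτ, hp⟩) (Real.sqrt_nonneg _)
  · exact (hc.comp (f := fun τ : ℝ => (τ, p)) (by fun_prop) fun τ hτ => ⟨hτ, hp⟩).mul
      continuousOn_const

end IsRicciFlow

end Cylinder

theorem mainTheorem2 (ρ : ℝ) (hρ : 0 < ρ) (g₀ : ℝ × ℝ → Matrix (Fin 2) (Fin 2) ℝ)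
    (hg₀ : Cylinder.IsMetric ρ g₀)
    (hR : ∀ p ∈ Cylinder.strip ρ, 0 ≤ Cylinder.scalarCurv ρ g₀ p)
    (hk : ∀ p : ℝ × ℝ, (p.2 = -ρ ∨ p.2 = ρ) → Cylinder.geodesicCurv ρ g₀ p ≤ 0) :
    ∃ c : ℝ, 0 < c ∧ ∀ (T : EReal) (g : ℝ → ℝ × ℝ → Matrix (Fin 2) (Fin 2) ℝ),
      Cylinder.IsRicciFlow ρ T g₀ g →
        ∀ t : ℝ, 0 < t → (t : EReal) < T → Cylinder.totalScalarCurv ρ (g t) ≤ c / t := by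
  have hmeas : MeasurableSet (Cylinder.fundDomain ρ) := measurableSet_Icc.prod measurableSet_Icc
  have hA₀ : 0 ≤ ∫ p in Cylinder.fundDomain ρ, √(g₀ p).det :=
    MeasureTheory.integral_nonneg fun p => Real.sqrt_nonneg _
  -- The constant is the initial area; adding `1` makes it positive without showing that the area
  -- is.
  refine ⟨(∫ p in Cylinder.fundDomain ρ, √(g₀ p).det) + 1, by linarith, fun T g H t ht htT => ?_⟩
  have hlt : ∀ τ ≤ t, (τ : EReal) < T := fun τ hτ =>
    lt_of_le_of_lt (EReal.coe_le_coe_iff.2 hτ) htT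
  have hderiv : ∀ τ ∈ interior (Icc 0 t), HasDerivAt (fun τ => ∫ p in Cylinder.fundDomain ρ,
      Cylinder.conformalFactor g₀ (g τ) p * √(g₀ p).det)
      (-Cylinder.totalScalarCurv ρ (g τ)) τ := fun τ hτ => by
    rw [interior_Icc] at hτ
    exact H.hasDerivAt_area hρ hg₀ hτ.1 (hlt τ hτ.2.le)
  -- On `(0, t)` the area has derivative `-S(τ) ≤ -S(t)`, so the mean value inequality gives `A(t) -
  -- A(0) ≤ -t S(t)`.
  have h := (convex_Icc 0 t).image_sub_le_mul_sub_of_deriv_le (H.continuousOn_area hg₀ htT)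
    (fun τ hτ => (hderiv τ hτ).differentiableAt.differentiableWithinAt)
    (C := -Cylinder.totalScalarCurv ρ (g t))
    (fun τ hτ => by
      rw [(hderiv τ hτ).deriv, neg_le_neg_iff]
      rw [interior_Icc] at hτ
      exact H.totalScalarCurv_antitone hρ hg₀ hR hk hτ.1 hτ.2 htT)
    0 ⟨le_rfl, ht.le⟩ t ⟨ht.le, le_rfl⟩ ht.le
  have hAt : 0 ≤ ∫ p in Cylinder.fundDomain ρ,
      Cylinder.conformalFactor g₀ (g t) p * √(g₀ p).det :=
    MeasureTheory.setIntegral_nonneg hmeas fun p hp => mul_nonneg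
      (H.conformalFactor_pos hg₀ ht.le htT (Cylinder.fundDomain_subset hp)).le (Real.sqrt_nonneg _)
  have hA0 : ∫ p in Cylinder.fundDomain ρ, Cylinder.conformalFactor g₀ (g 0) p * √(g₀ p).det =
      ∫ p in Cylinder.fundDomain ρ, √(g₀ p).det :=
    MeasureTheory.setIntegral_congr_fun hmeas fun p hp => by
      simp only [H.conformalFactor_zero hg₀ (Cylinder.fundDomain_subset hp), one_mul]
  rw [hA0] at h
  rw [le_div_iff₀ ht]
  linarith
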